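/- Let $r_2,r_1,r_0\in\mathbb Q$ be such that $d(x)=x^4+r_2x^2+r_1x+r_0$ is square-free, and suppose that for some $m\in\{4,5,6,7,8,9,10,12\}$ there are $a,b\in\mathbb Q$ such that no denominator below vanishes and $(r_2,r_1,r_0)$ is given by the row of $m$: - $m=4$: $r_2=\frac{8a-2}{b^2}$, $r_1=\frac{32a}{b^3}$, $r_0=\frac{16a^2+24a+1}{b^4}$. - $m=5$: $r_2=\frac{-2a^2+12a-2}{b^2}$, $r_1=\frac{32a}{b^3}$, $r_0=\frac{a^4-12a^3+6a^2+20a+1}{b^4}$. - $m=6$: $r_2=\frac{6a^2+12a-2}{b^2}$, $r_1=\frac{32a^2+32a}{b^3}$, $r_0=\frac{9a^4+4a^3+30a^2+20a+1}{b^4}$. - $m=7$: $r_2=\frac{-2a^4+12a^3-6a^2-4a-2}{b^2}$, $r_1=\frac{32a^3-32a^2}{b^3}$, $r_0=\frac{a^8-12a^7+42a^6-64a^5+51a^4-22a^2+4a+1}{b^4}$. - $m=8$: $r_2=\frac{8a^4+8a^3-32a^2+16a-2}{a^2b^2}$, $r_1=\frac{64a^2-96a+32}{b^3}$, $r_0=\frac{16a^8-96a^7+336a^6-576a^5+536a^4-296a^3+96a^2-16a+1}{a^4b^4}$.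 - $m=9$: $r_2=\frac{-2a^6+12a^5-18a^4+20a^3-12a^2-2}{b^2}$, $r_1=\frac{32a^5-64a^4+64a^3-32a^2}{b^3}$, $r_0=\frac{a^{12}-12a^{11}+54a^{10}-128a^9+181a^8-156a^7+82a^6-4a^5-42a^4+44a^3-20a^2+1}{b^4}$. - $m=10$: $r_2=\frac{-8a^6+32a^5-16a^4-16a^3+8a-2}{(a^2-3a+1)^2b^2}$, $r_1=\frac{64a^5-96a^4+32a^3}{(a^2-3a+1)^2b^3}$, $r_0=\frac{16a^{12}-128a^{11}+448a^{10}-896a^9+1024a^8-416a^7-408a^6+608a^5-304a^4+48a^3+16a^2-8a+1}{(a^2-3a+1)^4b^4}$. - $m=12$: $r_2=\frac{24a^8-240a^7+672a^6-936a^5+744a^4-336a^3+72a^2-2}{(a-1)^6b^2}$, $r_1=\frac{384a^6-960a^5+1088a^4-672a^3+224a^2-32a}{(a-1)^4b^3}$, $r_0=\frac{1}{(a-1)^{12}b^4}\bigl(144a^{16}-576a^{15}+2112a^{14}-9696a^{13}+34016a^{12}-82176a^{11}+141936a^{10}-181984a^9+177240a^8-132528a^7+76096a^6-33208a^5+10760a^4-2480a^3+376a^2-32a+1\bigr)$.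 Then $d(x)$ is Pellian over $\mathbb Q[x]$, i.e. $d$ is not a square in $\mathbb Q[x]$ and there are $f,g\in\mathbb Q[x]$ with $g\ne0$ and $f^2-d\,g^2=1$. Moreover, the function field $\mathbb Q(x,y)$, $y^2=d(x)$, has exactly two infinite places (places where $x$ has a pole), $\infty_+$ and $\infty_-$, and the class of the degree-zero divisor $\infty_+-\infty_-$ in $\mathrm{Pic}^0(\mathbb Q(x,y))$ (degree-zero divisors modulo principal divisors), equivalently the corresponding rational point on the Jacobian of $y^2=d(x)$, has order exactly $m$. -/

import Mathlib

open Polynomial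

noncomputable section

/-- A polynomial `d` over a commutative ring `R` is *Pellian over `R[x]`* if it is not a square and
`f ^ 2 - d * g ^ 2 = 1` has a solution in `R[x]` with `g ≠ 0`. -/
def IsPellian {R : Type*} [CommRing R] (d : R[X]) : Prop :=
  ¬ IsSquare d ∧ ∃ f g : R[X], g ≠ 0 ∧ f ^ 2 - d * g ^ 2 = 1

/-! ### Places, divisors and the degree zero class group of a function field `F / K` -/

/-- A place of a function field `F / K`: a discrete valuation ring of `F` (with fraction field `F`)
that contains the constants `K`. -/
structure Place (K F : Type*) [Field K] [Field F] [Algebra K F] where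
  /-- the valuation ring of the place -/
  ring : ValuationSubring F
  algebraMap_mem : ∀ c : K, algebraMap K F c ∈ ring
  isDVR : IsDiscreteValuationRing ring

namespace Place

variable {K F : Type*} [Field K] [Field F] [Algebra K F]

instance (P : Place K F) : IsDiscreteValuationRing P.ring := P.isDVR

instance (P : Place K F) : Algebra K P.ring :=
  ((algebraMap K F).codRestrict P.ring P.algebraMap_mem).toAlgebra

/-- The order of vanishing of `f` at the place `P`, that is, the normalized additive valuation:
positive at zeros and negative at poles. (Only its values at `f ≠ 0` are meaningful.) -/
def ord (P : Place K F) (f : F) : ℤ :=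
  -WithZero.log ((IsDiscreteValuationRing.maximalIdeal P.ring).valuation F f)

/-- The degree of a place: the degree over `K` of its residue field. -/
def degree (P : Place K F) : ℕ :=
  Module.finrank K (IsLocalRing.ResidueField P.ring)

lemma ord_one (P : Place K F) : P.ord 1 = 0 := by simp [ord]

lemma ord_mul (P : Place K F) {f g : F} (hf : f ≠ 0) (hg : g ≠ 0) :
    P.ord (f * g) = P.ord f + P.ord g := by
  unfold ord
  rw [map_mul, WithZero.log_mul (by simpa using hf) (by simpa using hg)]
  ring

lemma ord_inv (P : Place K F) (f : F) : P.ord f⁻¹ = -P.ord f := by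
  unfold ord
  rw [map_inv₀, WithZero.log_inv]

end Place

section ClassGroup

variable (K F : Type*) [Field K] [Field F] [Algebra K F]

/-- Divisors of `F / K`: finite formal sums of places. -/
abbrev PlaceDivisor : Type _ := Place K F →₀ ℤ

/-- The degree of a divisor, `∑ n_P P ↦ ∑ n_P deg P`. -/
def divisorDegree : PlaceDivisor K F →+ ℤ :=
  Finsupp.liftAddHom fun P => AddMonoidHom.mulRight (P.degree : ℤ)

/-- The group of divisors of degree zero. -/
def divisorZero : AddSubgroup (PlaceDivisor K F) := (divisorDegree K F).ker

/-- The group of principal divisors `∑ ord_P(f) P`, for `f ∈ Fˣ`. -/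
def principalDivisors : AddSubgroup (PlaceDivisor K F) where
  carrier := {D | ∃ f : F, f ≠ 0 ∧ ∀ P : Place K F, D P = P.ord f}
  zero_mem' := ⟨1, one_ne_zero, fun P => by simp [Place.ord_one]⟩
  add_mem' := by
    rintro D E ⟨f, hf, hD⟩ ⟨g, hg, hE⟩
    exact ⟨f * g, mul_ne_zero hf hg, fun P => by
      rw [Finsupp.add_apply, hD, hE, P.ord_mul hf hg]⟩
  neg_mem' := by
    rintro D ⟨f, hf, hD⟩
    exact ⟨f⁻¹, inv_ne_zero hf, fun P => by rw [Finsupp.neg_apply, hD, P.ord_inv]⟩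

/-- `Pic⁰(F)`: divisors of degree zero modulo principal divisors. -/
abbrev PicZero : Type _ :=
  divisorZero K F ⧸ (principalDivisors K F).addSubgroupOf (divisorZero K F)

end ClassGroup

/-! ### The function field of `y ^ 2 = d(x)` -/

/-- The polynomial `y ^ 2 - d(x)` in the variable `y` over `K(x)`. -/
def curvePolynomial {K : Type*} [Field K] (d : K[X]) : (RatFunc K)[X] :=
  X ^ 2 - C (algebraMap K[X] (RatFunc K) d)

lemma irreducible_curvePolynomial {K : Type*} [Field K] {d : K[X]} (hd : Squarefree d)
    (hu : ¬ IsUnit d) : Irreducible (curvePolynomial d) := by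
  unfold curvePolynomial
  refine (X_pow_sub_C_irreducible_iff_of_prime Nat.prime_two).2 fun r hr => hu ?_
  have hint : IsIntegral K[X] r := by
    refine ⟨X ^ 2 - C d, monic_X_pow_sub_C d two_ne_zero, ?_⟩
    simp [hr]
  obtain ⟨p, rfl⟩ := IsIntegrallyClosed.isIntegral_iff.1 hint
  have h : p ^ 2 = d := by
    apply IsFractionRing.injective K[X] (RatFunc K)
    rw [map_pow, hr]
  have hp : IsUnit p := hd p (by rw [← h, sq])
  rw [← h]
  exact hp.pow 2

/-- The function field `K(x, y)`, `y ^ 2 = d(x)`; it is a field as soon as `y ^ 2 - d(x)` is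
irreducible over `K(x)`. -/
abbrev CurveField {K : Type*} [Field K] (d : K[X]) : Type _ := AdjoinRoot (curvePolynomial d)

/-- A place of `K(x, y)` is infinite if the function `x` has a pole there. -/
def Place.IsInfinite {K : Type*} [Field K] {d : K[X]} [Fact (Irreducible (curvePolynomial d))]
    (P : Place K (CurveField d)) : Prop :=
  algebraMap (RatFunc K) (CurveField d) RatFunc.X ∉ P.ring

/-- The curve `y ^ 2 = d(x)` has exactly two infinite places `∞₊` and `∞₋`, the divisor `∞₊ - ∞₋`
has degree zero, and its class in `Pic⁰` (the group of rational points of the Jacobian) has order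
exactly `m`, where `m ≥ 1`. The order does not depend on which of the two places is called `∞₊`. -/
def InftyDifferenceHasOrder {K : Type*} [Field K] (d : K[X])
    [Fact (Irreducible (curvePolynomial d))] (m : ℕ) : Prop :=
  ∃ P Q : Place K (CurveField d), P ≠ Q ∧ (∀ R : Place K (CurveField d),
      R.IsInfinite ↔ R = P ∨ R = Q) ∧
    ∃ h : Finsupp.single P 1 - Finsupp.single Q 1 ∈ divisorZero K (CurveField d),
      0 < m ∧ addOrderOf (QuotientAddGroup.mk ⟨_, h⟩ : PicZero K (CurveField d)) = m

/-! ### Depressed quartics -/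

/-- The quartic `x ^ 4 + r₂ x ^ 2 + r₁ x + r₀`. -/
def depressedQuartic {K : Type*} [Field K] (r₂ r₁ r₀ : K) : K[X] :=
  X ^ 4 + C r₂ * X ^ 2 + C r₁ * X + C r₀

instance {K : Type*} [Field K] (r₂ r₁ r₀ : K) [hd : Fact (Squarefree (depressedQuartic r₂ r₁ r₀))] :
    Fact (Irreducible (curvePolynomial (depressedQuartic r₂ r₁ r₀))) := by
  refine ⟨irreducible_curvePolynomial hd.out fun hu => ?_⟩
  have h4 : (depressedQuartic r₂ r₁ r₀).natDegree = 4 := by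
    unfold depressedQuartic
    compute_degree!
  rw [natDegree_eq_zero_of_isUnit hu] at h4
  omega

/-- The table of parametrized coefficients: `CoefficientTable m a b r₂ r₁ r₀` says that `m` is one
of `4, …, 10, 12`, that no denominator in the row of `m` vanishes at `(a, b)` (the polynomial
`a ^ 2 - 3 * a + 1` in the row of `10` has no rational root), and that `r₂`, `r₁`, `r₀` are given by
the formulas of that row. -/
def CoefficientTable (m : ℕ) (a b r₂ r₁ r₀ : ℚ) : Prop :=
  match m with
  | 4 => b ≠ 0 ∧
      r₂ = (8 * a - 2) / b ^ 2 ∧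
      r₁ = 32 * a / b ^ 3 ∧
      r₀ = (16 * a ^ 2 + 24 * a + 1) / b ^ 4
  | 5 => b ≠ 0 ∧
      r₂ = (-2 * a ^ 2 + 12 * a - 2) / b ^ 2 ∧
      r₁ = 32 * a / b ^ 3 ∧
      r₀ = (a ^ 4 - 12 * a ^ 3 + 6 * a ^ 2 + 20 * a + 1) / b ^ 4
  | 6 => b ≠ 0 ∧
      r₂ = (6 * a ^ 2 + 12 * a - 2) / b ^ 2 ∧
      r₁ = (32 * a ^ 2 + 32 * a) / b ^ 3 ∧
      r₀ = (9 * a ^ 4 + 4 * a ^ 3 + 30 * a ^ 2 + 20 * a + 1) / b ^ 4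
  | 7 => b ≠ 0 ∧
      r₂ = (-2 * a ^ 4 + 12 * a ^ 3 - 6 * a ^ 2 - 4 * a - 2) / b ^ 2 ∧
      r₁ = (32 * a ^ 3 - 32 * a ^ 2) / b ^ 3 ∧
      r₀ = (a ^ 8 - 12 * a ^ 7 + 42 * a ^ 6 - 64 * a ^ 5 + 51 * a ^ 4 - 22 * a ^ 2
        + 4 * a + 1) / b ^ 4
  | 8 => a ≠ 0 ∧ b ≠ 0 ∧
      r₂ = (8 * a ^ 4 + 8 * a ^ 3 - 32 * a ^ 2 + 16 * a - 2) / (a ^ 2 * b ^ 2) ∧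
      r₁ = (64 * a ^ 2 - 96 * a + 32) / b ^ 3 ∧
      r₀ = (16 * a ^ 8 - 96 * a ^ 7 + 336 * a ^ 6 - 576 * a ^ 5 + 536 * a ^ 4 - 296 * a ^ 3
        + 96 * a ^ 2 - 16 * a + 1) / (a ^ 4 * b ^ 4)
  | 9 => b ≠ 0 ∧
      r₂ = (-2 * a ^ 6 + 12 * a ^ 5 - 18 * a ^ 4 + 20 * a ^ 3 - 12 * a ^ 2 - 2) / b ^ 2 ∧
      r₁ = (32 * a ^ 5 - 64 * a ^ 4 + 64 * a ^ 3 - 32 * a ^ 2) / b ^ 3 ∧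
      r₀ = (a ^ 12 - 12 * a ^ 11 + 54 * a ^ 10 - 128 * a ^ 9 + 181 * a ^ 8 - 156 * a ^ 7
        + 82 * a ^ 6 - 4 * a ^ 5 - 42 * a ^ 4 + 44 * a ^ 3 - 20 * a ^ 2 + 1) / b ^ 4
  | 10 => b ≠ 0 ∧
      r₂ = (-8 * a ^ 6 + 32 * a ^ 5 - 16 * a ^ 4 - 16 * a ^ 3 + 8 * a - 2)
        / ((a ^ 2 - 3 * a + 1) ^ 2 * b ^ 2) ∧
      r₁ = (64 * a ^ 5 - 96 * a ^ 4 + 32 * a ^ 3) / ((a ^ 2 - 3 * a + 1) ^ 2 * b ^ 3) ∧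
      r₀ = (16 * a ^ 12 - 128 * a ^ 11 + 448 * a ^ 10 - 896 * a ^ 9 + 1024 * a ^ 8
        - 416 * a ^ 7 - 408 * a ^ 6 + 608 * a ^ 5 - 304 * a ^ 4 + 48 * a ^ 3 + 16 * a ^ 2
        - 8 * a + 1) / ((a ^ 2 - 3 * a + 1) ^ 4 * b ^ 4)
  | 12 => a ≠ 1 ∧ b ≠ 0 ∧
      r₂ = (24 * a ^ 8 - 240 * a ^ 7 + 672 * a ^ 6 - 936 * a ^ 5 + 744 * a ^ 4 - 336 * a ^ 3
        + 72 * a ^ 2 - 2) / ((a - 1) ^ 6 * b ^ 2) ∧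
      r₁ = (384 * a ^ 6 - 960 * a ^ 5 + 1088 * a ^ 4 - 672 * a ^ 3 + 224 * a ^ 2 - 32 * a)
        / ((a - 1) ^ 4 * b ^ 3) ∧
      r₀ = (144 * a ^ 16 - 576 * a ^ 15 + 2112 * a ^ 14 - 9696 * a ^ 13 + 34016 * a ^ 12
        - 82176 * a ^ 11 + 141936 * a ^ 10 - 181984 * a ^ 9 + 177240 * a ^ 8
        - 132528 * a ^ 7 + 76096 * a ^ 6 - 33208 * a ^ 5 + 10760 * a ^ 4 - 2480 * a ^ 3
        + 376 * a ^ 2 - 32 * a + 1) / ((a - 1) ^ 12 * b ^ 4)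
  | _ => False

end

open Polynomial

/-! Let D = ∞₊ - ∞₋, where y ~ x² at ∞₊. A function without zeros or poles at finite places is a
unit of the ring of functions integral over K[x]. For squarefree d this ring is K[x] + K[x]y, so the
units are the p + qy with p² - dq² a nonzero constant. Comparing orders at infinity, kD is principal
for k > 0 exactly when such a unit exists with q ≠ 0 and deg p = k
(`nsmul_mem_principalDivisors_iff`). The order is therefore m once there is a unit of degree m and
none of degree m/ℓ for any prime ℓ ∣ m. A Pell solution is the square of a unit divided by its norm.

Units are found and excluded through the continued fraction of √d. A convergent of degree n with
linear norm marks a point R_n of the curve over x = e, with ordinate -(e² + t) and R_n - ∞₊ ~ -nD.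
Distinct points of a genus one curve are inequivalent, so nD is not principal
(`HasConvergent.not_hasPellUnit`). The parabola y = x² + t passes through the conjugate of R_n, and
its remaining finite intersection with the curve is R_{n+1} (`HasConvergent.succ`). The sequence can
close up in two ways: if R_{n+1} is conjugate to R_n then 2nD ~ 0
(`HasConvergent.hasPellUnit_even`), and if R_n is its own conjugate then (2n - 1)D ~ 0
(`HasConvergent.hasPellUnit_odd`). In each row of the table the points are explicit in a and are
followed up to n = ⌈m/2⌉. This reaches every m/ℓ except 1, and no unit has degree 1.

At infinity everything rests on `exists_hasLeading`: once the sign of y/x² is fixed, each nonzero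
function has a definite leading term c·xⁿ. This determines the two infinite places, their
discreteness and their degree. -/

noncomputable section

/-! ### Units and convergents for the norm form p² - dq². -/

section PellEquation

variable {K : Type*} [Field K]

/-- `d` admits a nontrivial solution of `p ^ 2 - d * q ^ 2 = c` with `c` a nonzero constant and
`deg p = m`. -/
def HasPellUnit (d : K[X]) (m : ℕ) : Prop :=
  ∃ (p q : K[X]) (c : K), c ≠ 0 ∧ q ≠ 0 ∧ p.natDegree = m ∧ p ^ 2 - d * q ^ 2 = C c

/-- `d` admits a convergent `p / q` of `√d` with `deg p = n` whose norm `p ^ 2 - d * q ^ 2` is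
linear with root `e`, and such that `p + q * (x ^ 2 + t)` vanishes at `e`. -/
def HasConvergent (d : K[X]) (n : ℕ) (e t : K) : Prop :=
  ∃ (p q : K[X]) (c : K), c ≠ 0 ∧ q ≠ 0 ∧ q.natDegree + 2 = n ∧ p.natDegree = n ∧
    p.leadingCoeff = q.leadingCoeff ∧ p ^ 2 - d * q ^ 2 = C c * (X - C e) ∧
    p.eval e + q.eval e * (e ^ 2 + t) = 0

lemma natDegree_mul_sq {d q : K[X]} (hd : d.Monic) (h4 : d.natDegree = 4) (hq : q ≠ 0) :
    (d * q ^ 2).natDegree = 4 + 2 * q.natDegree := by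
  rw [natDegree_mul hd.ne_zero (pow_ne_zero 2 hq), natDegree_pow, h4]

/-- The degrees and leading coefficients of a solution of `p ^ 2 - d * q ^ 2 = r` with
`deg r ≤ 1`. -/
lemma natDegree_and_leadingCoeff_of_norm {d p q r : K[X]} (hd : d.Monic) (h4 : d.natDegree = 4)
    (hq : q ≠ 0) (hr : r.natDegree ≤ 1) (h : p ^ 2 - d * q ^ 2 = r) :
    p.natDegree = q.natDegree + 2 ∧ p.leadingCoeff ^ 2 = q.leadingCoeff ^ 2 := by
  have hp : p ^ 2 = d * q ^ 2 + r := by rw [← h]; ring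
  have hlt : r.natDegree < (d * q ^ 2).natDegree := by
    rw [natDegree_mul_sq hd h4 hq]; omega
  constructor
  · have := congrArg natDegree hp
    rw [natDegree_add_eq_left_of_natDegree_lt hlt, natDegree_mul_sq hd h4 hq, natDegree_pow] at this
    omega
  · have := congrArg leadingCoeff hp
    rwa [leadingCoeff_add_of_degree_lt' (degree_lt_degree hlt), leadingCoeff_mul, hd.leadingCoeff,
      one_mul, leadingCoeff_pow, leadingCoeff_pow] at this

lemma two_le_of_hasPellUnit {d : K[X]} (hd : d.Monic) (h4 : d.natDegree = 4) {m : ℕ}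
    (h : HasPellUnit d m) : 2 ≤ m := by
  obtain ⟨p, q, c, -, hq, rfl, h⟩ := h
  have := (natDegree_and_leadingCoeff_of_norm hd h4 hq (by simp) h).1
  omega

/-- The unit can be normalized so that `p` and `q` have the same leading coefficient. -/
lemma HasPellUnit.exists_leadingCoeff_eq {d : K[X]} (hd : d.Monic) (h4 : d.natDegree = 4) {m : ℕ}
    (h : HasPellUnit d m) : ∃ (p q : K[X]) (c : K), c ≠ 0 ∧ q ≠ 0 ∧ q.natDegree + 2 = m ∧
      p.natDegree = m ∧ p.leadingCoeff = q.leadingCoeff ∧ p ^ 2 - d * q ^ 2 = C c := by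
  obtain ⟨p, q, c, hc, hq, rfl, h⟩ := h
  obtain ⟨hdeg, hlead⟩ := natDegree_and_leadingCoeff_of_norm hd h4 hq (by simp) h
  rcases sq_eq_sq_iff_eq_or_eq_neg.1 hlead with hl | hl
  · exact ⟨p, q, c, hc, hq, hdeg.symm, rfl, hl, h⟩
  · exact ⟨p, -q, c, hc, neg_ne_zero.2 hq, by rw [natDegree_neg, hdeg], rfl,
      by rw [hl, leadingCoeff_neg], by rw [neg_sq, h]⟩

/-- A convergent of degree `n` with linear norm excludes units of degree `n`. -/
lemma HasConvergent.not_hasPellUnit [NeZero (2 : K)] {d : K[X]} (hd : d.Monic)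
    (h4 : d.natDegree = 4) {n : ℕ} {e t : K} (h : HasConvergent d n e t) : ¬ HasPellUnit d n := by
  intro hu
  obtain ⟨P, Q, c, hc, hQ, hQn, hPn, hPQ, hN⟩ := hu.exists_leadingCoeff_eq hd h4
  obtain ⟨p, q, c', hc', hq, hqn, hpn, hpq, hn, -⟩ := h
  have hL : (C c' * (X - C e)).natDegree = 1 := by
    rw [natDegree_C_mul hc', natDegree_X_sub_C]
  -- The right side has degree at most 2 deg q + 1. Equal leading coefficients prevent cancellation
  -- in Pq + Qp, which has degree 2 deg q + 2, so Pq = Qp. The remaining identity c q² = c'(X - e)Q²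
  -- is impossible by parity of degrees.
  have key : (P * q - Q * p) * (P * q + Q * p) = C c * q ^ 2 - C c' * (X - C e) * Q ^ 2 := by
    rw [← hN, ← hn]; ring
  have hlc : (P * q).coeff (n + q.natDegree) = P.leadingCoeff * q.leadingCoeff := by
    rw [← hPn, coeff_mul_degree_add_degree]
  have hlc' : (Q * p).coeff (n + q.natDegree) = P.leadingCoeff * q.leadingCoeff := by
    have : n + q.natDegree = Q.natDegree + p.natDegree := by omega
    rw [this, coeff_mul_degree_add_degree, hPQ, hpq]
  have hdeg : n + q.natDegree ≤ (P * q + Q * p).natDegree := by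
    apply le_natDegree_of_ne_zero
    rw [coeff_add, hlc, hlc', ← two_mul]
    have hP : P ≠ 0 := by rintro rfl; simp at hPn; omega
    exact mul_ne_zero two_ne_zero
      (mul_ne_zero (leadingCoeff_ne_zero.2 hP) (leadingCoeff_ne_zero.2 hq))
  have hrdeg : (C c * q ^ 2 - C c' * (X - C e) * Q ^ 2).natDegree ≤ 2 * q.natDegree + 1 := by
    refine (natDegree_sub_le _ _).trans (max_le ?_ ?_)
    · rw [natDegree_C_mul hc, natDegree_pow]; omega
    · refine natDegree_mul_le.trans ?_
      rw [hL, natDegree_pow]; omega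
  have hzero : P * q - Q * p = 0 := by
    by_contra hne
    have hne' : P * q + Q * p ≠ 0 := by
      intro h0; rw [h0, natDegree_zero] at hdeg; omega
    rw [← key, natDegree_mul hne hne'] at hrdeg
    omega
  rw [hzero, zero_mul] at key
  have := congrArg natDegree (sub_eq_zero.1 key.symm)
  rw [natDegree_C_mul hc, natDegree_pow,
    natDegree_mul (mul_ne_zero (C_ne_zero.2 hc') (X_sub_C_ne_zero e)) (pow_ne_zero 2 hQ), hL,
    natDegree_pow] at this
  omega

/-! ### Convergents of a depressed quartic -/

lemma depressedQuartic_monic (r₂ r₁ r₀ : K) : (depressedQuartic r₂ r₁ r₀).Monic := by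
  unfold depressedQuartic
  monicity!

lemma natDegree_depressedQuartic (r₂ r₁ r₀ : K) : (depressedQuartic r₂ r₁ r₀).natDegree = 4 := by
  unfold depressedQuartic
  compute_degree!

lemma natDegree_sq_add_C (t : K) : (X ^ 2 + C t : K[X]).natDegree = 2 := by
  compute_degree!

lemma monic_sq_add_C (t : K) : (X ^ 2 + C t : K[X]).Monic := by
  monicity!

/-- Completing the square: x² + r₂/2 is the polynomial part of √d, and its norm -r₁(x - e) is linear
because r₁ ≠ 0. -/
lemma hasConvergent_two {r₂ r₁ r₀ e t : K} [NeZero (2 : K)] (hr₁ : r₁ ≠ 0)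
    (he : r₂ ^ 2 / 4 - r₀ = r₁ * e) (ht : r₂ / 2 + 2 * e ^ 2 + t = 0) :
    HasConvergent (depressedQuartic r₂ r₁ r₀) 2 e t := by
  have h2 : (2 : K) ≠ 0 := two_ne_zero
  refine ⟨X ^ 2 + C (r₂ / 2), 1, -r₁, neg_ne_zero.2 hr₁, one_ne_zero, by simp,
    natDegree_sq_add_C _, by rw [(monic_sq_add_C _).leadingCoeff, leadingCoeff_one], ?_, ?_⟩
  · have h : r₀ = (r₂ / 2) ^ 2 - r₁ * e := by
      rw [← he]
      have h4 : (4 : K) ≠ 0 := by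
        rw [show (4 : K) = 2 * 2 by norm_num]; exact mul_ne_zero h2 h2
      field_simp
      ring
    have hr₂ : C r₂ = 2 * C (r₂ / 2) := by
      rw [← C_ofNat, ← C_mul]; congr 1; field_simp
    rw [depressedQuartic, h, hr₂]
    simp only [C_sub, C_mul, C_neg, C_pow]
    ring
  · simp only [eval_add, eval_pow, eval_X, eval_C, eval_one]
    rw [← ht]; ring

/-- The hypotheses compare coefficients in d - (x² + t)² = s(x - e)(x - e'): the parabola y = x² + t
meets the curve over e and e'. -/
lemma depressedQuartic_sub_sq {r₂ r₁ r₀ s e e' t : K} (hs : s = r₂ - 2 * t)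
    (h₁ : r₁ = -s * (e + e')) (h₀ : r₀ - t ^ 2 = s * e * e') :
    depressedQuartic r₂ r₁ r₀ = (X ^ 2 + C t) ^ 2 + C s * (X - C e) * (X - C e') := by
  have h₀' : r₀ = t ^ 2 + s * e * e' := by rw [← h₀]; ring
  have h₂ : r₂ = s + 2 * t := by rw [hs]; ring
  rw [depressedQuartic, h₀', h₁, h₂]
  simp only [C_add, C_mul, C_neg, C_pow, C_ofNat]
  ring

/-- The quotient `(p + q * (x ^ 2 + t)) / (x - e)` attached to a convergent. -/
lemma exists_quotient [NeZero (2 : K)] {p q : K[X]} {e t : K} (hq : q ≠ 0)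
    (hpq : p.natDegree = q.natDegree + 2) (hl : p.leadingCoeff = q.leadingCoeff)
    (he : p.eval e + q.eval e * (e ^ 2 + t) = 0) :
    ∃ u : K[X], p + q * (X ^ 2 + C t) = (X - C e) * u ∧ u ≠ 0 ∧
      u.natDegree = q.natDegree + 1 := by
  obtain ⟨u, hu⟩ : X - C e ∣ p + q * (X ^ 2 + C t) := by
    rw [dvd_iff_isRoot]; simpa using he
  have hc : (p + q * (X ^ 2 + C t)).coeff (q.natDegree + 2) ≠ 0 := by
    have h₁ : (q * (X ^ 2 + C t)).coeff (q.natDegree + 2) = q.leadingCoeff := by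
      have := coeff_mul_degree_add_degree q (X ^ 2 + C t)
      rwa [natDegree_sq_add_C, (monic_sq_add_C t).leadingCoeff, mul_one] at this
    rw [coeff_add, h₁, ← hpq, coeff_natDegree, hl, ← two_mul]
    exact mul_ne_zero two_ne_zero (leadingCoeff_ne_zero.2 hq)
  have hdeg : (p + q * (X ^ 2 + C t)).natDegree = q.natDegree + 2 := by
    refine le_antisymm ((natDegree_add_le _ _).trans (max_le hpq.le ?_))
      (le_natDegree_of_ne_zero hc)
    exact natDegree_mul_le.trans (by rw [natDegree_sq_add_C])
  have hu0 : u ≠ 0 := by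
    rintro rfl
    rw [hu, mul_zero, coeff_zero] at hc
    exact hc rfl
  refine ⟨u, hu, hu0, ?_⟩
  rw [hu, natDegree_mul (X_sub_C_ne_zero e) hu0, natDegree_X_sub_C] at hdeg
  omega

/-- The next convergent is (p + q√d)(x² + t + √d)/(x - e). The two norms multiply to a multiple of
(x - e)²(x - e'), and division by x - e removes the square. The condition on t' gives the new point
the ordinate e'² + t, so that it lies on the parabola. -/
lemma HasConvergent.succ [NeZero (2 : K)] {r₂ r₁ r₀ s e e' t t' : K} {n : ℕ}
    (h : HasConvergent (depressedQuartic r₂ r₁ r₀) n e t) (hs0 : s ≠ 0) (hs : s = r₂ - 2 * t)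
    (h₁ : r₁ = -s * (e + e')) (h₀ : r₀ - t ^ 2 = s * e * e') (ht : t + t' + 2 * e' ^ 2 = 0) :
    HasConvergent (depressedQuartic r₂ r₁ r₀) (n + 1) e' t' := by
  have hd := depressedQuartic_sub_sq hs h₁ h₀
  obtain ⟨p, q, c, hc, hq, hqn, hpn, hpq, hn, he⟩ := h
  obtain ⟨u, hu, hu0, hun⟩ := exists_quotient hq (by omega) hpq he
  have hnorm : ((X ^ 2 + C t) * u + C s * (X - C e') * q) ^ 2
      - depressedQuartic r₂ r₁ r₀ * u ^ 2 = C (-c * s) * (X - C e') := by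
    have hX : (X - C e) ^ 2 ≠ 0 := pow_ne_zero 2 (X_sub_C_ne_zero e)
    apply mul_left_cancel₀ hX
    have hA : (X - C e) * ((X ^ 2 + C t) * u + C s * (X - C e') * q)
        = p * (X ^ 2 + C t) + depressedQuartic r₂ r₁ r₀ * q := by
      rw [hd]; linear_combination (-(X ^ 2 + C t)) * hu
    have hB : depressedQuartic r₂ r₁ r₀ - (X ^ 2 + C t) ^ 2 = C s * (X - C e) * (X - C e') := by
      rw [hd]; ring
    calc _ = ((X - C e) * ((X ^ 2 + C t) * u + C s * (X - C e') * q)) ^ 2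
          - depressedQuartic r₂ r₁ r₀ * ((X - C e) * u) ^ 2 := by ring
      _ = -(p ^ 2 - depressedQuartic r₂ r₁ r₀ * q ^ 2)
          * (depressedQuartic r₂ r₁ r₀ - (X ^ 2 + C t) ^ 2) := by rw [hA, ← hu]; ring
      _ = _ := by rw [hn, hB]; simp only [C_mul, C_neg]; ring
  have hlt : (C s * (X - C e') * q).natDegree < ((X ^ 2 + C t) * u).natDegree := by
    rw [natDegree_mul (mul_ne_zero (C_ne_zero.2 hs0) (X_sub_C_ne_zero _)) hq,
      natDegree_C_mul hs0, natDegree_X_sub_C, natDegree_mul (monic_sq_add_C t).ne_zero hu0,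
      natDegree_sq_add_C]
    omega
  refine ⟨_, u, -c * s, mul_ne_zero (neg_ne_zero.2 hc) hs0, hu0, by omega, ?_, ?_, hnorm, ?_⟩
  · rw [natDegree_add_eq_left_of_natDegree_lt hlt, natDegree_mul (monic_sq_add_C t).ne_zero hu0,
      natDegree_sq_add_C]
    omega
  · rw [leadingCoeff_add_of_degree_lt' (degree_lt_degree hlt), leadingCoeff_mul,
      (monic_sq_add_C t).leadingCoeff, one_mul]
  · simp only [eval_add, eval_mul, eval_pow, eval_X, eval_C, eval_sub]
    linear_combination (eval e' u) * ht

/-- A convergent of degree `n` whose successor has the same root yields a unit of degree `2 n`. -/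
lemma HasConvergent.hasPellUnit_even [NeZero (2 : K)] {r₂ r₁ r₀ s e t : K} {n : ℕ}
    (h : HasConvergent (depressedQuartic r₂ r₁ r₀) n e t) (hs0 : s ≠ 0) (hs : s = r₂ - 2 * t)
    (h₁ : r₁ = -s * (e + e)) (h₀ : r₀ - t ^ 2 = s * e * e) :
    HasPellUnit (depressedQuartic r₂ r₁ r₀) (2 * n) := by
  have hd := depressedQuartic_sub_sq hs h₁ h₀
  obtain ⟨p, q, c, hc, hq, hqn, hpn, hpq, hn, he⟩ := h
  obtain ⟨u, hu, hu0, hun⟩ := exists_quotient hq (by omega) hpq he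
  have hc0 : -(c ^ 2) * s ≠ 0 := mul_ne_zero (neg_ne_zero.2 (pow_ne_zero 2 hc)) hs0
  -- This is the product of p + q√d with its successor, divided by x - e. Both norms are multiples
  -- of x - e, so the quotient has constant norm and degree n + (n + 1) - 1.
  have hnorm : ((X ^ 2 + C t) * u ^ 2 + C s * (X - C e) * q * u + C s * p * q) ^ 2
      - depressedQuartic r₂ r₁ r₀ * (u ^ 2 + C s * q ^ 2) ^ 2 = C (-(c ^ 2) * s) := by
    have hX : (X - C e) ^ 2 ≠ 0 := pow_ne_zero 2 (X_sub_C_ne_zero e)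
    have hA : (X - C e) * ((X ^ 2 + C t) * u ^ 2 + C s * (X - C e) * q * u + C s * p * q)
        = u * (p * (X ^ 2 + C t) + depressedQuartic r₂ r₁ r₀ * q) + C s * (X - C e) * p * q := by
      rw [hd]; linear_combination (-(X ^ 2 + C t)) * u * hu
    have hB : (X - C e) * (u ^ 2 + C s * q ^ 2)
        = u * (p + q * (X ^ 2 + C t)) + C s * (X - C e) * q ^ 2 := by
      linear_combination (-u) * hu
    have hC : depressedQuartic r₂ r₁ r₀ - (X ^ 2 + C t) ^ 2 = C s * (X - C e) * (X - C e) := by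
      rw [hd]; ring
    apply mul_left_cancel₀ hX
    calc _ = ((X - C e) * ((X ^ 2 + C t) * u ^ 2 + C s * (X - C e) * q * u + C s * p * q)) ^ 2
          - depressedQuartic r₂ r₁ r₀ * ((X - C e) * (u ^ 2 + C s * q ^ 2)) ^ 2 := by ring
      _ = (p ^ 2 - depressedQuartic r₂ r₁ r₀ * q ^ 2) *
          (((X ^ 2 + C t) * u + C s * (X - C e) * q) ^ 2
            - depressedQuartic r₂ r₁ r₀ * u ^ 2) := by rw [hA, hB]; ring
      _ = (C c * (X - C e)) * (u ^ 2 * ((X ^ 2 + C t) ^ 2 - depressedQuartic r₂ r₁ r₀)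
          + C s * (X - C e) * q * (2 * (X ^ 2 + C t) * u + C s * (X - C e) * q)) := by
        rw [hn]; ring
      _ = (C c * (X - C e)) * (C s * (-((X - C e) * u) ^ 2
          + (X - C e) * u * (2 * q * (X ^ 2 + C t)) + C s * (X - C e) ^ 2 * q ^ 2)) := by
        rw [← neg_sub (depressedQuartic r₂ r₁ r₀), hC]; ring
      _ = (C c * (X - C e)) * (C s * (-(p ^ 2 - depressedQuartic r₂ r₁ r₀ * q ^ 2))) := by
        rw [← hu, hd]; ring
      _ = _ := by rw [hn]; simp only [C_mul, C_neg, C_pow]; ring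
  have hlt : (C s * q ^ 2).natDegree < (u ^ 2).natDegree := by
    rw [natDegree_C_mul hs0, natDegree_pow, natDegree_pow]; omega
  have hdeg : (u ^ 2 + C s * q ^ 2).natDegree + 2 = 2 * n := by
    rw [natDegree_add_eq_left_of_natDegree_lt hlt, natDegree_pow]; omega
  have hB0 : u ^ 2 + C s * q ^ 2 ≠ 0 := by
    intro h0
    have := natDegree_add_eq_left_of_natDegree_lt hlt
    rw [h0, natDegree_zero] at this
    omega
  refine ⟨_, _, _, hc0, hB0, ?_, hnorm⟩
  rw [(natDegree_and_leadingCoeff_of_norm (depressedQuartic_monic _ _ _)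
    (natDegree_depressedQuartic _ _ _) hB0 ((natDegree_C _).le.trans zero_le_one) hnorm).1, hdeg]

/-- A convergent of degree `n` whose norm vanishes at a root of `d` yields a unit of degree
`2 n - 1`. -/
lemma HasConvergent.hasPellUnit_odd [NeZero (2 : K)] {r₂ r₁ r₀ e t : K} {n : ℕ}
    (h : HasConvergent (depressedQuartic r₂ r₁ r₀) n e t)
    (h0 : e ^ 4 + r₂ * e ^ 2 + r₁ * e + r₀ = 0) :
    HasPellUnit (depressedQuartic r₂ r₁ r₀) (2 * n - 1) := by
  obtain ⟨p, q, c, hc, hq, hqn, hpn, hpq, hn, -⟩ := h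
  have hde : (depressedQuartic r₂ r₁ r₀).eval e = 0 := by
    simpa [depressedQuartic] using h0
  have hpe : p.eval e = 0 := by
    have := congrArg (eval e) hn
    simpa [hde] using this
  obtain ⟨d₁, hd₁⟩ := dvd_iff_isRoot.2 hde
  obtain ⟨p₁, hp₁⟩ := dvd_iff_isRoot.2 hpe
  have hp10 : p₁ ≠ 0 := by rintro rfl; rw [hp₁] at hpn; simp at hpn; omega
  have hp1n : p.natDegree = 1 + p₁.natDegree := by
    rw [hp₁, natDegree_mul (X_sub_C_ne_zero e) hp10, natDegree_X_sub_C]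
  have hone : (X - C e) * p₁ ^ 2 - d₁ * q ^ 2 = C c := by
    apply mul_left_cancel₀ (X_sub_C_ne_zero e)
    rw [hd₁, hp₁] at hn
    linear_combination hn
  -- This is (p + q√d)²/(x - e), which has polynomial coefficients because x - e divides both d and
  -- p.
  have hnorm : ((X - C e) * p₁ ^ 2 + d₁ * q ^ 2) ^ 2
      - depressedQuartic r₂ r₁ r₀ * (C 2 * (p₁ * q)) ^ 2 = C (c ^ 2) := by
    rw [hd₁, C_pow, ← hone, C_ofNat]; ring
  have hB0 : C 2 * (p₁ * q) ≠ 0 := mul_ne_zero (C_ne_zero.2 two_ne_zero) (mul_ne_zero hp10 hq)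
  refine ⟨_, _, _, pow_ne_zero 2 hc, hB0, ?_, hnorm⟩
  rw [(natDegree_and_leadingCoeff_of_norm (depressedQuartic_monic _ _ _)
    (natDegree_depressedQuartic _ _ _) hB0 (by simp) hnorm).1, natDegree_C_mul two_ne_zero,
    natDegree_mul hp10 hq]
  omega

end PellEquation

/-! ### Explicit chains of convergents for the rows of the table. -/

section Table

/-- The depressed quartic with roots scaled by `B⁻¹`. -/
def scaledQuartic (B R₂ R₁ R₀ : ℚ) : ℚ[X] :=
  depressedQuartic (R₂ / B ^ 2) (R₁ / B ^ 3) (R₀ / B ^ 4)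

/-- If `r₁ = 0` and `r₂ ^ 2 = 4 r₀` then the quartic is a square. -/
lemma linearCoeff_ne_zero_of_squarefree {B R₂ R₁ R₀ : ℚ}
    (hd : Squarefree (scaledQuartic B R₂ R₁ R₀)) (E : ℚ)
    (hE : R₂ ^ 2 / 4 - R₀ = R₁ * E) : R₁ ≠ 0 := by
  rintro rfl
  have hR₀ : R₀ = (R₂ / 2) ^ 2 := by linear_combination -hE
  have h : scaledQuartic B R₂ 0 R₀ =
      (X ^ 2 + C (R₂ / 2 / B ^ 2)) * (X ^ 2 + C (R₂ / 2 / B ^ 2)) := by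
    rw [scaledQuartic, depressedQuartic, hR₀, show R₂ / B ^ 2 = 2 * (R₂ / 2 / B ^ 2) by ring,
      show (R₂ / 2) ^ 2 / B ^ 4 = (R₂ / 2 / B ^ 2) ^ 2 by ring]
    simp only [zero_div, C_0, C_mul, C_pow, C_ofNat]
    ring
  have := natDegree_eq_zero_of_isUnit (hd _ (dvd_of_eq h.symm))
  rw [natDegree_sq_add_C] at this
  omega

lemma hasConvergent_two_scaled {B R₂ R₁ R₀ : ℚ} (hB : B ≠ 0)
    (hd : Squarefree (scaledQuartic B R₂ R₁ R₀)) (E T : ℚ)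
    (hE : R₂ ^ 2 / 4 - R₀ = R₁ * E) (hT : R₂ / 2 + 2 * E ^ 2 + T = 0) :
    HasConvergent (scaledQuartic B R₂ R₁ R₀) 2 (E / B) (T / B ^ 2) := by
  have hR₁ := linearCoeff_ne_zero_of_squarefree hd E hE
  refine hasConvergent_two (div_ne_zero hR₁ (pow_ne_zero 3 hB)) ?_ ?_
  · field_simp; linear_combination 4 * hE
  · field_simp; linear_combination 2 * hT

lemma HasConvergent.succ_scaled {B R₂ R₁ R₀ E T : ℚ} {n : ℕ} (hB : B ≠ 0)
    (h : HasConvergent (scaledQuartic B R₂ R₁ R₀) n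
      (E / B) (T / B ^ 2)) (hR₁ : R₁ ≠ 0) (E' T' : ℚ)
    (h₁ : R₁ = -(R₂ - 2 * T) * (E + E')) (h₀ : R₀ - T ^ 2 = (R₂ - 2 * T) * E * E')
    (hT : T + T' + 2 * E' ^ 2 = 0) :
    HasConvergent (scaledQuartic B R₂ R₁ R₀) (n + 1)
      (E' / B) (T' / B ^ 2) := by
  have hs : R₂ - 2 * T ≠ 0 := fun h0 => hR₁ (by rw [h₁, h0]; ring)
  refine h.succ (s := (R₂ - 2 * T) / B ^ 2) (div_ne_zero hs (pow_ne_zero 2 hB)) (by ring) ?_ ?_ ?_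
  · rw [h₁]; field_simp
  · field_simp; linear_combination h₀
  · field_simp; linear_combination hT

lemma HasConvergent.hasPellUnit_even_scaled {B R₂ R₁ R₀ E T : ℚ} {n : ℕ} (hB : B ≠ 0)
    (h : HasConvergent (scaledQuartic B R₂ R₁ R₀) n
      (E / B) (T / B ^ 2)) (hR₁ : R₁ ≠ 0)
    (h₁ : R₁ = -(R₂ - 2 * T) * (E + E)) (h₀ : R₀ - T ^ 2 = (R₂ - 2 * T) * E * E) :
    HasPellUnit (scaledQuartic B R₂ R₁ R₀) (2 * n) := by
  have hs : R₂ - 2 * T ≠ 0 := fun h0 => hR₁ (by rw [h₁, h0]; ring)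
  refine h.hasPellUnit_even (s := (R₂ - 2 * T) / B ^ 2) (div_ne_zero hs (pow_ne_zero 2 hB))
    (by ring) ?_ ?_
  · rw [h₁]; field_simp
  · field_simp; linear_combination h₀

lemma HasConvergent.hasPellUnit_odd_scaled {B R₂ R₁ R₀ E T : ℚ} {n : ℕ} (hB : B ≠ 0)
    (h : HasConvergent (scaledQuartic B R₂ R₁ R₀) n
      (E / B) (T / B ^ 2)) (h0 : E ^ 4 + R₂ * E ^ 2 + R₁ * E + R₀ = 0) :
    HasPellUnit (scaledQuartic B R₂ R₁ R₀) (2 * n - 1) := by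
  refine h.hasPellUnit_odd ?_
  field_simp
  linear_combination h0

/-- `m` is the smallest positive degree of a unit, in the form of a divisibility criterion. -/
def IsPellOrder (d : ℚ[X]) (m : ℕ) : Prop :=
  HasPellUnit d m ∧ ∀ ℓ : ℕ, ℓ.Prime → ℓ ∣ m → ¬ HasPellUnit d (m / ℓ)

lemma sq_sub_three_mul_add_one_ne_zero (a : ℚ) : a ^ 2 - 3 * a + 1 ≠ 0 := by
  intro h
  -- The discriminant of a² - 3a + 1 is 5.
  have h5 : IsSquare (5 : ℚ) := ⟨2 * a - 3, by linear_combination -4 * h⟩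
  rw [show (5 : ℚ) = ((5 : ℕ) : ℚ) by norm_num, Rat.isSquare_natCast_iff] at h5
  exact Nat.prime_five.prime.not_isSquare h5

lemma not_hasPellUnit_one_scaled {B R₂ R₁ R₀ : ℚ} :
    ¬ HasPellUnit (scaledQuartic B R₂ R₁ R₀) 1 := by
  intro h
  have := two_le_of_hasPellUnit (depressedQuartic_monic _ _ _) (natDegree_depressedQuartic _ _ _) h
  omega

lemma HasConvergent.not_hasPellUnit_scaled {B R₂ R₁ R₀ e t : ℚ} {n : ℕ}
    (h : HasConvergent (scaledQuartic B R₂ R₁ R₀) n e t) :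
    ¬ HasPellUnit (scaledQuartic B R₂ R₁ R₀) n :=
  h.not_hasPellUnit (depressedQuartic_monic _ _ _) (natDegree_depressedQuartic _ _ _)

lemma isPellOrder_four {a b r₂ r₁ r₀ : ℚ} (h : CoefficientTable 4 a b r₂ r₁ r₀)
    (hd : Squarefree (depressedQuartic r₂ r₁ r₀)) :
    IsPellOrder (depressedQuartic r₂ r₁ r₀) 4 := by
  obtain ⟨hb, h₂, h₁, h₀⟩ := h
  have h : depressedQuartic r₂ r₁ r₀ = scaledQuartic b (8 * a - 2) (32 * a) (16 * a ^ 2 + 24 * a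
    + 1) := by
    rw [h₂, h₁, h₀, scaledQuartic]
  rw [h] at hd ⊢
  -- The chain is forced in this row and in the others: it starts with E = (R₂²/4 - R₀)/R₁ and T =
  -- -R₂/2 - 2E², and continues with E' = -R₁/(R₂ - 2T) - E and T' = -T - 2E'².
  have hR := linearCoeff_ne_zero_of_squarefree hd (-1) (by ring)
  have c₂ := hasConvergent_two_scaled hb hd (-1) (-4 * a - 1) (by ring) (by ring)
  refine ⟨c₂.hasPellUnit_even_scaled hb hR (by ring) (by ring), fun ℓ hℓ hdvd => ?_⟩
  have hle := Nat.le_of_dvd (by norm_num) hdvd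
  -- Only prime divisors ℓ of m survive, and the convergent of degree m/ℓ excludes a unit of that
  -- degree.
  interval_cases ℓ <;> first
    | omega
    | (norm_num at hℓ; done)
    | exact c₂.not_hasPellUnit_scaled

lemma isPellOrder_five {a b r₂ r₁ r₀ : ℚ} (h : CoefficientTable 5 a b r₂ r₁ r₀)
    (hd : Squarefree (depressedQuartic r₂ r₁ r₀)) :
    IsPellOrder (depressedQuartic r₂ r₁ r₀) 5 := by
  obtain ⟨hb, h₂, h₁, h₀⟩ := h
  have h : depressedQuartic r₂ r₁ r₀ = scaledQuartic b (-2 * a ^ 2 + 12 * a - 2) (32 * a) (a ^ 4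
    - 12 * a ^ 3 + 6 * a ^ 2 + 20 * a + 1) := by
    rw [h₂, h₁, h₀, scaledQuartic]
  rw [h] at hd ⊢
  have hR := linearCoeff_ne_zero_of_squarefree hd (a - 1) (by ring)
  have c₂ := hasConvergent_two_scaled hb hd (a - 1) (-a ^ 2 - 2 * a - 1) (by ring) (by ring)
  have c₃ := c₂.succ_scaled hb hR (-a - 1) (-a ^ 2 - 2 * a - 1) (by ring) (by ring) (by ring)
  -- The last two convergents share the same T, so E² + T = 0 at the last one: its point has
  -- ordinate 0 and E is a root of the quartic. The rows of 7 and 9 close in the same way.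
  refine ⟨c₃.hasPellUnit_odd_scaled hb (by ring), fun ℓ hℓ hdvd => ?_⟩
  have hle := Nat.le_of_dvd (by norm_num) hdvd
  interval_cases ℓ <;> first
    | omega
    | (norm_num at hℓ; done)
    | exact not_hasPellUnit_one_scaled

lemma isPellOrder_six {a b r₂ r₁ r₀ : ℚ} (h : CoefficientTable 6 a b r₂ r₁ r₀)
    (hd : Squarefree (depressedQuartic r₂ r₁ r₀)) :
    IsPellOrder (depressedQuartic r₂ r₁ r₀) 6 := by
  obtain ⟨hb, h₂, h₁, h₀⟩ := h
  have h : depressedQuartic r₂ r₁ r₀ = scaledQuartic b (6 * a ^ 2 + 12 * a - 2) (32 * a ^ 2 + 32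
    * a) (9 * a ^ 4 + 4 * a ^ 3 + 30 * a ^ 2 + 20 * a + 1) := by
    rw [h₂, h₁, h₀, scaledQuartic]
  rw [h] at hd ⊢
  have hR := linearCoeff_ne_zero_of_squarefree hd (a - 1) (by ring)
  have c₂ := hasConvergent_two_scaled hb hd (a - 1) (-5 * a ^ 2 - 2 * a - 1) (by ring) (by ring)
  have c₃ := c₂.succ_scaled hb hR (-a - 1) (3 * a ^ 2 - 2 * a - 1) (by ring) (by ring) (by ring)
  refine ⟨c₃.hasPellUnit_even_scaled hb hR (by ring) (by ring), fun ℓ hℓ hdvd => ?_⟩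
  have hle := Nat.le_of_dvd (by norm_num) hdvd
  interval_cases ℓ <;> first
    | omega
    | (norm_num at hℓ; done)
    | exact c₃.not_hasPellUnit_scaled
    | exact c₂.not_hasPellUnit_scaled

lemma isPellOrder_seven {a b r₂ r₁ r₀ : ℚ} (h : CoefficientTable 7 a b r₂ r₁ r₀)
    (hd : Squarefree (depressedQuartic r₂ r₁ r₀)) :
    IsPellOrder (depressedQuartic r₂ r₁ r₀) 7 := by
  obtain ⟨hb, h₂, h₁, h₀⟩ := h
  have h : depressedQuartic r₂ r₁ r₀ = scaledQuartic b (-2 * a ^ 4 + 12 * a ^ 3 - 6 * a ^ 2 - 4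
    * a - 2) (32 * a ^ 3 - 32 * a ^ 2) (a ^ 8 - 12 * a ^ 7 + 42 * a ^ 6 - 64 * a ^ 5 + 51 * a ^
    4 - 22 * a ^ 2 + 4 * a + 1) := by
    rw [h₂, h₁, h₀, scaledQuartic]
  rw [h] at hd ⊢
  have hR := linearCoeff_ne_zero_of_squarefree hd (a ^ 2 - a - 1) (by ring)
  have c₂ := hasConvergent_two_scaled hb hd (a ^ 2 - a - 1) (-a ^ 4 - 2 * a ^ 3 + 5 * a ^ 2 - 2 *
    a - 1) (by ring) (by ring)
  have c₃ := c₂.succ_scaled hb hR (-a ^ 2 + a - 1) (-a ^ 4 + 6 * a ^ 3 - 11 * a ^ 2 + 6 * a - 1)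
    (by ring) (by ring) (by ring)
  have c₄ := c₃.succ_scaled hb hR (a ^ 2 - 3 * a + 1) (-a ^ 4 + 6 * a ^ 3 - 11 * a ^ 2 + 6 * a -
    1) (by ring) (by ring) (by ring)
  refine ⟨c₄.hasPellUnit_odd_scaled hb (by ring), fun ℓ hℓ hdvd => ?_⟩
  have hle := Nat.le_of_dvd (by norm_num) hdvd
  interval_cases ℓ <;> first
    | omega
    | (norm_num at hℓ; done)
    | exact not_hasPellUnit_one_scaled

lemma isPellOrder_eight {a b r₂ r₁ r₀ : ℚ} (h : CoefficientTable 8 a b r₂ r₁ r₀)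
    (hd : Squarefree (depressedQuartic r₂ r₁ r₀)) :
    IsPellOrder (depressedQuartic r₂ r₁ r₀) 8 := by
  obtain ⟨ha, hb, h₂, h₁, h₀⟩ := h
  have h : depressedQuartic r₂ r₁ r₀ = scaledQuartic (a * b) (8 * a ^ 4 + 8 * a ^ 3 - 32 * a ^ 2 +
    16 * a - 2) ((64 * a ^ 2 - 96 * a + 32) * a ^ 3) (16 * a ^ 8 - 96 * a ^ 7 + 336 * a ^ 6 -
    576 * a ^ 5 + 536 * a ^ 4 - 296 * a ^ 3 + 96 * a ^ 2 - 16 * a + 1) := by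
    rw [h₂, h₁, h₀, scaledQuartic]
    congr 1 <;> field_simp
  rw [h] at hd ⊢
  have hR := linearCoeff_ne_zero_of_squarefree hd (2 * a ^ 2 - 4 * a + 1) (by ring)
  have c₂ := hasConvergent_two_scaled (mul_ne_zero ha hb) hd (2 * a ^ 2 - 4 * a + 1) (-12 * a ^ 4
    + 28 * a ^ 3 - 24 * a ^ 2 + 8 * a - 1) (by ring) (by ring)
  have c₃ := c₂.succ_scaled (mul_ne_zero ha hb) hR (-2 * a ^ 2 + 2 * a - 1) (4 * a ^ 4 - 12 * a ^
    3 + 8 * a ^ 2 - 1) (by ring) (by ring) (by ring)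
  have c₄ := c₃.succ_scaled (mul_ne_zero ha hb) hR (-2 * a + 1) (-4 * a ^ 4 + 12 * a ^ 3 - 16 * a
    ^ 2 + 8 * a - 1) (by ring) (by ring) (by ring)
  refine ⟨c₄.hasPellUnit_even_scaled (mul_ne_zero ha hb) hR (by ring) (by ring), fun ℓ hℓ hdvd =>
    ?_⟩
  have hle := Nat.le_of_dvd (by norm_num) hdvd
  interval_cases ℓ <;> first
    | omega
    | (norm_num at hℓ; done)
    | exact c₄.not_hasPellUnit_scaled

lemma isPellOrder_nine {a b r₂ r₁ r₀ : ℚ} (h : CoefficientTable 9 a b r₂ r₁ r₀)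
    (hd : Squarefree (depressedQuartic r₂ r₁ r₀)) :
    IsPellOrder (depressedQuartic r₂ r₁ r₀) 9 := by
  obtain ⟨hb, h₂, h₁, h₀⟩ := h
  have h : depressedQuartic r₂ r₁ r₀ = scaledQuartic b (-2 * a ^ 6 + 12 * a ^ 5 - 18 * a ^ 4 +
    20 * a ^ 3 - 12 * a ^ 2 - 2) (32 * a ^ 5 - 64 * a ^ 4 + 64 * a ^ 3 - 32 * a ^ 2) (a ^ 12 -
    12 * a ^ 11 + 54 * a ^ 10 - 128 * a ^ 9 + 181 * a ^ 8 - 156 * a ^ 7 + 82 * a ^ 6 - 4 * a ^ 5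
    - 42 * a ^ 4 + 44 * a ^ 3 - 20 * a ^ 2 + 1) := by
    rw [h₂, h₁, h₀, scaledQuartic]
  rw [h] at hd ⊢
  have hR := linearCoeff_ne_zero_of_squarefree hd (a ^ 3 - a ^ 2 - 1) (by ring)
  have c₂ := hasConvergent_two_scaled hb hd (a ^ 3 - a ^ 2 - 1) (-a ^ 6 - 2 * a ^ 5 + 7 * a ^ 4 -
    6 * a ^ 3 + 2 * a ^ 2 - 1) (by ring) (by ring)
  have c₃ := c₂.succ_scaled hb hR (-a ^ 3 + a ^ 2 - 1) (-a ^ 6 + 6 * a ^ 5 - 9 * a ^ 4 + 2 * a ^ 3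
    + 2 * a ^ 2 - 1) (by ring) (by ring) (by ring)
  have c₄ := c₃.succ_scaled hb hR (a ^ 3 - 3 * a ^ 2 + 2 * a - 1) (-a ^ 6 + 6 * a ^ 5 - 17 * a ^ 4
    + 26 * a ^ 3 - 22 * a ^ 2 + 8 * a - 1) (by ring) (by ring) (by ring)
  have c₅ := c₄.succ_scaled hb hR (-a ^ 3 + 3 * a ^ 2 - 4 * a + 1) (-a ^ 6 + 6 * a ^ 5 - 17 * a ^
    4 + 26 * a ^ 3 - 22 * a ^ 2 + 8 * a - 1) (by ring) (by ring) (by ring)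
  refine ⟨c₅.hasPellUnit_odd_scaled hb (by ring), fun ℓ hℓ hdvd => ?_⟩
  have hle := Nat.le_of_dvd (by norm_num) hdvd
  interval_cases ℓ <;> first
    | omega
    | (norm_num at hℓ; done)
    | exact c₃.not_hasPellUnit_scaled

lemma isPellOrder_ten {a b r₂ r₁ r₀ : ℚ} (h : CoefficientTable 10 a b r₂ r₁ r₀)
    (hd : Squarefree (depressedQuartic r₂ r₁ r₀)) :
    IsPellOrder (depressedQuartic r₂ r₁ r₀) 10 := by
  obtain ⟨hb, h₂, h₁, h₀⟩ := h
  have ha : a ^ 2 - 3 * a + 1 ≠ 0 := sq_sub_three_mul_add_one_ne_zero a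
  have h : depressedQuartic r₂ r₁ r₀ = scaledQuartic ((a ^ 2 - 3 * a + 1) * b) (-8 * a ^ 6 + 32 *
    a ^ 5 - 16 * a ^ 4 - 16 * a ^ 3 + 8 * a - 2) ((64 * a ^ 5 - 96 * a ^ 4 + 32 * a ^ 3) * (a ^
    2 - 3 * a + 1)) (16 * a ^ 12 - 128 * a ^ 11 + 448 * a ^ 10 - 896 * a ^ 9 + 1024 * a ^ 8 -
    416 * a ^ 7 - 408 * a ^ 6 + 608 * a ^ 5 - 304 * a ^ 4 + 48 * a ^ 3 + 16 * a ^ 2 - 8 * a + 1)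
    := by
    rw [h₂, h₁, h₀, scaledQuartic]
    congr 1 <;> field_simp
  rw [h] at hd ⊢
  have hR := linearCoeff_ne_zero_of_squarefree hd (-2 * a ^ 3 + 2 * a ^ 2 + 2 * a - 1) (by ring)
  have c₂ := hasConvergent_two_scaled (mul_ne_zero ha hb) hd (-2 * a ^ 3 + 2 * a ^ 2 + 2 * a - 1)
    (-4 * a ^ 6 + 16 * a ^ 4 - 16 * a ^ 3 + 4 * a - 1) (by ring) (by ring)
  have c₃ := c₂.succ_scaled (mul_ne_zero ha hb) hR (2 * a ^ 3 - 4 * a ^ 2 + 4 * a - 1) (-4 * a ^ 6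
    + 32 * a ^ 5 - 80 * a ^ 4 + 88 * a ^ 3 - 48 * a ^ 2 + 12 * a - 1) (by ring) (by ring) (by
    ring)
  have c₄ := c₃.succ_scaled (mul_ne_zero ha hb) hR (-2 * a ^ 3 + 6 * a ^ 2 - 4 * a + 1) (-4 * a ^
    6 + 16 * a ^ 5 - 24 * a ^ 4 + 16 * a ^ 3 - 8 * a ^ 2 + 4 * a - 1) (by ring) (by ring) (by
    ring)
  have c₅ := c₄.succ_scaled (mul_ne_zero ha hb) hR (2 * a - 1) (4 * a ^ 6 - 16 * a ^ 5 + 24 * a ^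
    4 - 16 * a ^ 3 + 4 * a - 1) (by ring) (by ring) (by ring)
  refine ⟨c₅.hasPellUnit_even_scaled (mul_ne_zero ha hb) hR (by ring) (by ring), fun ℓ hℓ hdvd =>
    ?_⟩
  have hle := Nat.le_of_dvd (by norm_num) hdvd
  interval_cases ℓ <;> first
    | omega
    | (norm_num at hℓ; done)
    | exact c₅.not_hasPellUnit_scaled
    | exact c₂.not_hasPellUnit_scaled

lemma isPellOrder_twelve {a b r₂ r₁ r₀ : ℚ} (h : CoefficientTable 12 a b r₂ r₁ r₀)
    (hd : Squarefree (depressedQuartic r₂ r₁ r₀)) :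
    IsPellOrder (depressedQuartic r₂ r₁ r₀) 12 := by
  obtain ⟨ha, hb, h₂, h₁, h₀⟩ := h
  have ha' : a - 1 ≠ 0 := sub_ne_zero.2 ha
  -- The scale (a - 1)³b is dictated by the denominators of r₂ and r₀. That of r₁ contains only (a -
  -- 1)⁴ instead of (a - 1)⁹, hence the extra factor (a - 1)⁵.
  have h : depressedQuartic r₂ r₁ r₀ = scaledQuartic ((a - 1) ^ 3 * b) (24 * a ^ 8 - 240 * a ^ 7 +
    672 * a ^ 6 - 936 * a ^ 5 + 744 * a ^ 4 - 336 * a ^ 3 + 72 * a ^ 2 - 2) ((384 * a ^ 6 - 960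
    * a ^ 5 + 1088 * a ^ 4 - 672 * a ^ 3 + 224 * a ^ 2 - 32 * a) * (a - 1) ^ 5) (144 * a ^ 16 -
    576 * a ^ 15 + 2112 * a ^ 14 - 9696 * a ^ 13 + 34016 * a ^ 12 - 82176 * a ^ 11 + 141936 * a
    ^ 10 - 181984 * a ^ 9 + 177240 * a ^ 8 - 132528 * a ^ 7 + 76096 * a ^ 6 - 33208 * a ^ 5 +
    10760 * a ^ 4 - 2480 * a ^ 3 + 376 * a ^ 2 - 32 * a + 1) := by
    rw [h₂, h₁, h₀, scaledQuartic]
    congr 1 <;> field_simp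
  rw [h] at hd ⊢
  have hR := linearCoeff_ne_zero_of_squarefree hd (-6 * a ^ 4 + 8 * a ^ 3 - 2 * a ^ 2 - 2 * a + 1)
    (by ring)
  have c₂ := hasConvergent_two_scaled (mul_ne_zero (pow_ne_zero 3 ha') hb) hd (-6 * a ^ 4 + 8 * a
    ^ 3 - 2 * a ^ 2 - 2 * a + 1) (-84 * a ^ 8 + 312 * a ^ 7 - 512 * a ^ 6 + 484 * a ^ 5 - 292 *
    a ^ 4 + 120 * a ^ 3 - 36 * a ^ 2 + 8 * a - 1) (by ring) (by ring)
  have c₃ := c₂.succ_scaled (mul_ne_zero (pow_ne_zero 3 ha') hb) hR (6 * a ^ 4 - 10 * a ^ 3 + 8 *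
    a ^ 2 - 4 * a + 1) (12 * a ^ 8 - 72 * a ^ 7 + 120 * a ^ 6 - 68 * a ^ 5 - 20 * a ^ 4 + 48 * a
    ^ 3 - 28 * a ^ 2 + 8 * a - 1) (by ring) (by ring) (by ring)
  have c₄ := c₃.succ_scaled (mul_ne_zero (pow_ne_zero 3 ha') hb) hR (-2 * a ^ 4 - 2 * a ^ 3 + 6 *
    a ^ 2 - 4 * a + 1) (-20 * a ^ 8 + 56 * a ^ 7 - 80 * a ^ 6 + 84 * a ^ 5 - 76 * a ^ 4 + 56 * a
    ^ 3 - 28 * a ^ 2 + 8 * a - 1) (by ring) (by ring) (by ring)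
  have c₅ := c₄.succ_scaled (mul_ne_zero (pow_ne_zero 3 ha') hb) hR (2 * a ^ 4 - 4 * a ^ 3 + 6 * a
    ^ 2 - 4 * a + 1) (12 * a ^ 8 - 24 * a ^ 7 + 44 * a ^ 5 - 68 * a ^ 4 + 56 * a ^ 3 - 28 * a ^
    2 + 8 * a - 1) (by ring) (by ring) (by ring)
  have c₆ := c₅.succ_scaled (mul_ne_zero (pow_ne_zero 3 ha') hb) hR (-4 * a ^ 3 + 6 * a ^ 2 - 4 *
    a + 1) (-12 * a ^ 8 + 24 * a ^ 7 - 32 * a ^ 6 + 52 * a ^ 5 - 68 * a ^ 4 + 56 * a ^ 3 - 28 *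
    a ^ 2 + 8 * a - 1) (by ring) (by ring) (by ring)
  refine ⟨c₆.hasPellUnit_even_scaled (mul_ne_zero (pow_ne_zero 3 ha') hb) hR (by ring) (by ring),
    fun ℓ hℓ hdvd => ?_⟩
  have hle := Nat.le_of_dvd (by norm_num) hdvd
  interval_cases ℓ <;> first
    | omega
    | (norm_num at hℓ; done)
    | exact c₆.not_hasPellUnit_scaled
    | exact c₄.not_hasPellUnit_scaled

lemma isPellOrder_of_coefficientTable {m : ℕ} {a b r₂ r₁ r₀ : ℚ}
    (h : CoefficientTable m a b r₂ r₁ r₀) (hd : Squarefree (depressedQuartic r₂ r₁ r₀)) :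
    IsPellOrder (depressedQuartic r₂ r₁ r₀) m :=
  match m, h with
  | 4, h => isPellOrder_four h hd
  | 5, h => isPellOrder_five h hd
  | 6, h => isPellOrder_six h hd
  | 7, h => isPellOrder_seven h hd
  | 8, h => isPellOrder_eight h hd
  | 9, h => isPellOrder_nine h hd
  | 10, h => isPellOrder_ten h hd
  | 12, h => isPellOrder_twelve h hd

end Table

/-! ### The function field: coordinates, conjugation and the form α + βy. -/

section CurveField

variable {K : Type*} [Field K] {d : K[X]}

/-- The function `x` on the curve. -/
def curveX (d : K[X]) : CurveField d := algebraMap (RatFunc K) (CurveField d) RatFunc.X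

/-- The function `y` on the curve. -/
def curveY (d : K[X]) : CurveField d := AdjoinRoot.root (curvePolynomial d)

lemma algebraMap_X_curveField : algebraMap K[X] (CurveField d) X = curveX d := by
  rw [IsScalarTower.algebraMap_apply K[X] (RatFunc K) (CurveField d), RatFunc.algebraMap_X]
  rfl

lemma algebraMap_C_curveField (c : K) :
    algebraMap K[X] (CurveField d) (C c) = algebraMap K (CurveField d) c := by
  rw [IsScalarTower.algebraMap_apply K K[X] (CurveField d)]
  rfl

lemma curveY_sq : curveY d ^ 2 = algebraMap K[X] (CurveField d) d := by
  have h := AdjoinRoot.eval₂_root (curvePolynomial d)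
  rw [curvePolynomial] at h
  simp only [eval₂_sub, eval₂_pow, eval₂_X, eval₂_C, sub_eq_zero] at h
  rw [IsScalarTower.algebraMap_apply K[X] (RatFunc K) (CurveField d)]
  exact h

/-- The hyperelliptic involution `y ↦ -y`. -/
def curveConj (d : K[X]) : CurveField d →ₐ[RatFunc K] CurveField d :=
  AdjoinRoot.liftAlgHom (curvePolynomial d) (Algebra.ofId _ _) (-curveY d) (by
    simp only [curvePolynomial, eval₂_sub, eval₂_pow, eval₂_X, eval₂_C, neg_sq, curveY_sq]
    rw [IsScalarTower.algebraMap_apply K[X] (RatFunc K) (CurveField d)]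
    exact sub_self _)

@[simp] lemma curveConj_Y : curveConj d (curveY d) = -curveY d :=
  AdjoinRoot.liftAlgHom_root ..

@[simp] lemma curveConj_algebraMap (p : K[X]) :
    curveConj d (algebraMap K[X] (CurveField d) p) = algebraMap K[X] (CurveField d) p := by
  rw [IsScalarTower.algebraMap_apply K[X] (RatFunc K) (CurveField d), AlgHom.commutes]

@[simp] lemma curveConj_const (c : K) :
    curveConj d (algebraMap K (CurveField d) c) = algebraMap K (CurveField d) c := by
  rw [← algebraMap_C_curveField, curveConj_algebraMap]

@[simp] lemma curveConj_X : curveConj d (curveX d) = curveX d := by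
  rw [← algebraMap_X_curveField, curveConj_algebraMap]

lemma exists_ratFunc_add_mul (f : CurveField d) : ∃ α β : RatFunc K,
    f = algebraMap (RatFunc K) (CurveField d) α
      + algebraMap (RatFunc K) (CurveField d) β * curveY d := by
  have hm : (curvePolynomial d).Monic := monic_X_pow_sub_C _ two_ne_zero
  have hdeg : (curvePolynomial d).natDegree = 2 := natDegree_X_pow_sub_C
  obtain ⟨g, rfl⟩ := AdjoinRoot.mk_surjective f
  have hg : (g %ₘ curvePolynomial d).natDegree ≤ 1 := by
    have := natDegree_modByMonic_lt g hm (by intro h; rw [h, natDegree_one] at hdeg; omega)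
    omega
  refine ⟨(g %ₘ curvePolynomial d).coeff 0, (g %ₘ curvePolynomial d).coeff 1, ?_⟩
  have h : AdjoinRoot.mk (curvePolynomial d) g
      = AdjoinRoot.mk (curvePolynomial d) (g %ₘ curvePolynomial d) := by
    rw [AdjoinRoot.mk_eq_mk]
    exact dvd_sub_comm.1 (by
      rw [modByMonic_eq_sub_mul_div, sub_sub_cancel_left]
      exact (dvd_mul_right _ _).neg_right)
  rw [h]
  conv_lhs => rw [eq_X_add_C_of_natDegree_le_one hg]
  rw [map_add, map_mul, AdjoinRoot.mk_X, add_comm]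
  rfl

variable [Fact (Irreducible (curvePolynomial d))]

lemma algebraMap_curveField_injective :
    Function.Injective (algebraMap K[X] (CurveField d)) := by
  rw [IsScalarTower.algebraMap_eq K[X] (RatFunc K) (CurveField d)]
  exact (algebraMap (RatFunc K) (CurveField d)).injective.comp (IsFractionRing.injective _ _)

lemma exists_polynomial_add_mul (f : CurveField d) : ∃ p q r : K[X], r ≠ 0 ∧
    f * algebraMap K[X] (CurveField d) r = algebraMap K[X] (CurveField d) p
      + algebraMap K[X] (CurveField d) q * curveY d := by
  obtain ⟨α, β, rfl⟩ := exists_ratFunc_add_mul f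
  classical
  obtain ⟨⟨r, hr⟩, h⟩ := IsLocalization.exist_integer_multiples_of_finset
    (nonZeroDivisors K[X]) ({α, β} : Finset (RatFunc K))
  obtain ⟨p, hp⟩ := h α (by simp)
  obtain ⟨q, hq⟩ := h β (by simp)
  refine ⟨p, q, r, nonZeroDivisors.ne_zero hr, ?_⟩
  simp only [IsScalarTower.algebraMap_apply K[X] (RatFunc K) (CurveField d)]
  rw [hp, hq, Algebra.smul_def, Algebra.smul_def, map_mul, map_mul]
  ring

lemma curveX_ne_zero : curveX d ≠ 0 := by
  rw [← algebraMap_X_curveField]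
  exact (map_ne_zero_iff _ algebraMap_curveField_injective).2 X_ne_zero

lemma curveY_ne_zero : curveY d ≠ 0 := by
  intro h
  have hd : d = 0 := by
    apply algebraMap_curveField_injective (d := d)
    rw [← curveY_sq, h, map_zero]; ring
  have hirr : Irreducible (curvePolynomial d) := Fact.out
  rw [hd, curvePolynomial, map_zero, C_0, sub_zero] at hirr
  exact hirr.not_isSquare ⟨X, sq X⟩

end CurveField

/-! ### Leading terms at infinity -/

section Leading

variable {K : Type*} [Field K] {d : K[X]} [Fact (Irreducible (curvePolynomial d))]

/-- `f` is `c * x ^ n` up to terms of smaller order with respect to `V`. -/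
def HasLeading (V : ValuationSubring (CurveField d)) (f : CurveField d) (n : ℤ) (c : K) : Prop :=
  V.valuation (f * curveX d ^ (-n) - algebraMap K (CurveField d) c) < 1

/-- `V` contains the constants but not `x`. -/
structure IsInfiniteRing (V : ValuationSubring (CurveField d)) : Prop where
  const_mem : ∀ c : K, algebraMap K (CurveField d) c ∈ V
  x_not_mem : curveX d ∉ V

variable {V : ValuationSubring (CurveField d)}

namespace IsInfiniteRing

lemma valuation_const_le (hV : IsInfiniteRing V) (c : K) :
    V.valuation (algebraMap K (CurveField d) c) ≤ 1 :=
  (V.valuation_le_one_iff _).2 (hV.const_mem c)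

lemma valuation_const (hV : IsInfiniteRing V) {c : K} (hc : c ≠ 0) :
    V.valuation (algebraMap K (CurveField d) c) = 1 := by
  refine le_antisymm (hV.valuation_const_le c) ?_
  have h := hV.valuation_const_le c⁻¹
  have hc' : V.valuation (algebraMap K (CurveField d) c) ≠ 0 := by
    simpa using hc
  rw [map_inv₀, map_inv₀] at h
  exact (inv_le_one₀ (zero_lt_iff.2 hc')).1 h

lemma one_lt_valuation_X (hV : IsInfiniteRing V) : 1 < V.valuation (curveX d) := by
  rw [← not_le, V.valuation_le_one_iff]
  exact hV.x_not_mem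

lemma eq_zero_of_valuation_lt (hV : IsInfiniteRing V) {c : K}
    (h : V.valuation (algebraMap K (CurveField d) c) < 1) : c = 0 := by
  by_contra hc
  exact h.ne (hV.valuation_const hc)

end IsInfiniteRing

namespace HasLeading

lemma valuation_mul_le (hV : IsInfiniteRing V) {f : CurveField d} {n : ℤ} {c : K}
    (h : HasLeading V f n c) : V.valuation (f * curveX d ^ (-n)) ≤ 1 := by
  have := V.valuation.map_add (f * curveX d ^ (-n) - algebraMap K (CurveField d) c)
    (algebraMap K (CurveField d) c)
  rw [sub_add_cancel] at this
  exact this.trans (max_le h.le (hV.valuation_const_le c))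

lemma valuation_mul_eq (hV : IsInfiniteRing V) {f : CurveField d} {n : ℤ} {c : K} (hc : c ≠ 0)
    (h : HasLeading V f n c) : V.valuation (f * curveX d ^ (-n)) = 1 := by
  have hc1 := hV.valuation_const hc
  rw [← hc1]
  exact V.valuation.map_eq_of_sub_lt (by rw [hc1]; exact h)

lemma valuation_eq (hV : IsInfiniteRing V) {f : CurveField d} {n : ℤ} {c : K} (hc : c ≠ 0)
    (h : HasLeading V f n c) : V.valuation f = V.valuation (curveX d) ^ n := by
  have := h.valuation_mul_eq hV hc
  rw [map_mul, map_zpow₀, zpow_neg] at this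
  have hx : V.valuation (curveX d) ^ n ≠ 0 :=
    zpow_ne_zero _ ((V.valuation.ne_zero_iff).2 curveX_ne_zero)
  exact (mul_inv_eq_one₀ hx).1 this

lemma add {f g : CurveField d} {n : ℤ} {c e : K} (hf : HasLeading V f n c)
    (hg : HasLeading V g n e) : HasLeading V (f + g) n (c + e) := by
  unfold HasLeading at *
  rw [show (f + g) * curveX d ^ (-n) - algebraMap K (CurveField d) (c + e)
    = (f * curveX d ^ (-n) - algebraMap K (CurveField d) c)
      + (g * curveX d ^ (-n) - algebraMap K (CurveField d) e) by rw [map_add]; ring]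
  exact V.valuation.map_add_lt hf hg

lemma mul (hV : IsInfiniteRing V) {f g : CurveField d} {n m : ℤ} {c e : K}
    (hf : HasLeading V f n c) (hg : HasLeading V g m e) :
    HasLeading V (f * g) (n + m) (c * e) := by
  have hfle := hf.valuation_mul_le hV
  unfold HasLeading at *
  rw [show (f * g) * curveX d ^ (-(n + m)) - algebraMap K (CurveField d) (c * e)
    = (f * curveX d ^ (-n)) * (g * curveX d ^ (-m) - algebraMap K (CurveField d) e)
      + algebraMap K (CurveField d) e * (f * curveX d ^ (-n) - algebraMap K (CurveField d) c) by
    rw [map_mul, neg_add, zpow_add₀ curveX_ne_zero]; ring]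
  refine V.valuation.map_add_lt ?_ ?_
  · rw [map_mul]
    exact mul_lt_one_of_nonneg_of_lt_one_right hfle zero_le hg
  · rw [map_mul]
    exact mul_lt_one_of_nonneg_of_lt_one_right (hV.valuation_const_le e) zero_le hf

lemma inv (hV : IsInfiniteRing V) {f : CurveField d} {n : ℤ} {c : K} (hc : c ≠ 0)
    (h : HasLeading V f n c) : HasLeading V f⁻¹ (-n) c⁻¹ := by
  have h1 := h.valuation_mul_eq hV hc
  have hc1 := hV.valuation_const hc
  unfold HasLeading at *
  set g := f * curveX d ^ (-n) with hg
  have hg0 : g ≠ 0 := by rintro h0; rw [h0, map_zero] at h1; exact zero_ne_one h1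
  have hc0 : algebraMap K (CurveField d) c ≠ 0 := by simpa using hc
  have hgi : f⁻¹ * curveX d ^ (- -n) = g⁻¹ := by rw [hg, mul_inv, ← zpow_neg]
  rw [hgi, map_inv₀, show g⁻¹ - (algebraMap K (CurveField d) c)⁻¹
    = -(g - algebraMap K (CurveField d) c) * (g⁻¹ * (algebraMap K (CurveField d) c)⁻¹) by
      field_simp; ring, map_mul, map_mul, map_inv₀, map_inv₀, h1, hc1, Valuation.map_neg]
  simpa using h

lemma const (c : K) :
    HasLeading V (algebraMap K (CurveField d) c) 0 c := by
  simp [HasLeading]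

lemma var : HasLeading V (curveX d) 1 1 := by
  simp [HasLeading, curveX_ne_zero]

/-- The coefficient c = 0 is allowed in `HasLeading`, which then only bounds the pole. This lets
terms of different orders be added at a common order. -/
lemma succ (hV : IsInfiniteRing V) {f : CurveField d} {n : ℤ} {c : K} (h : HasLeading V f n c) :
    HasLeading V f (n + 1) 0 := by
  have h1 := h.valuation_mul_le hV
  rw [HasLeading, neg_add, zpow_add₀ curveX_ne_zero, map_zero, sub_zero, ← mul_assoc, map_mul,
    zpow_neg_one, map_inv₀]
  exact mul_lt_one_of_nonneg_of_lt_one_right h1 zero_le (inv_lt_one_of_one_lt₀ hV.one_lt_valuation_X)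

lemma const_succ (hV : IsInfiniteRing V) (n : ℕ) (c : K) :
    HasLeading V (algebraMap K (CurveField d) c) (n + 1 : ℕ) 0 := by
  induction n with
  | zero => exact (const c).succ hV
  | succ n ih => exact_mod_cast ih.succ hV

lemma polynomial (hV : IsInfiniteRing V) (n : ℕ) (p : K[X]) (hp : p.natDegree ≤ n) :
    HasLeading V (algebraMap K[X] (CurveField d) p) n (p.coeff n) := by
  induction n generalizing p with
  | zero =>
    rw [eq_C_of_natDegree_le_zero hp, algebraMap_C_curveField, coeff_C_zero]
    exact const _
  | succ n ih =>
    have h := ((ih p.divX (by rw [natDegree_divX_eq_natDegree_tsub_one]; omega)).mul hV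
      var).add (const_succ hV n (p.coeff 0))
    rw [mul_one, add_zero, coeff_divX, ← algebraMap_X_curveField, ← map_mul,
      ← algebraMap_C_curveField, ← map_add, divX_mul_X_add] at h
    exact h

/-- The leading term of `p + q y` at a place where `y` is `ε x ^ 2` to first order. -/
lemma add_mul_Y (hV : IsInfiniteRing V) {ε : K} (hY : HasLeading V (curveY d) 2 ε) (n : ℕ)
    {p q : K[X]} (hp : p.natDegree ≤ n + 2) (hq : q.natDegree ≤ n) :
    HasLeading V (algebraMap K[X] (CurveField d) p + algebraMap K[X] (CurveField d) q * curveY d)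
      (n + 2 : ℤ) (p.coeff (n + 2) + q.coeff n * ε) := by
  have h := polynomial hV (n + 2) p hp
  rw [Nat.cast_add, Nat.cast_ofNat] at h
  exact h.add ((polynomial hV n q hq).mul hV hY)

lemma mem_iff (hV : IsInfiniteRing V) {f : CurveField d} {n : ℤ} {c : K} (hc : c ≠ 0)
    (h : HasLeading V f n c) : f ∈ V ↔ n ≤ 0 := by
  rw [← V.valuation_le_one_iff, h.valuation_eq hV hc,
    zpow_le_one_iff_right₀ hV.one_lt_valuation_X]

end HasLeading

lemma algebraMap_norm (p q : K[X]) : algebraMap K[X] (CurveField d) (p ^ 2 - d * q ^ 2)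
    = (algebraMap K[X] (CurveField d) p + algebraMap K[X] (CurveField d) q * curveY d)
      * (algebraMap K[X] (CurveField d) p - algebraMap K[X] (CurveField d) q * curveY d) := by
  simp only [map_sub, map_mul, map_pow]
  linear_combination (algebraMap K[X] (CurveField d) q) ^ 2 * curveY_sq (d := d)

lemma norm_ne_zero {p q : K[X]} (h : algebraMap K[X] (CurveField d) p
    + algebraMap K[X] (CurveField d) q * curveY d ≠ 0) : p ^ 2 - d * q ^ 2 ≠ 0 := by
  rw [← map_ne_zero_iff _ (algebraMap_curveField_injective (d := d)), algebraMap_norm]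
  refine mul_ne_zero h ?_
  have := (map_ne_zero (curveConj d)).2 h
  simpa [sub_eq_add_neg] using this

/-- The leading term of a nonzero function depends only on the leading coefficient `ε` of `y`. -/
theorem exists_hasLeading [NeZero (2 : K)] {ε : K} (hε : ε ^ 2 = 1) {f : CurveField d}
    (hf : f ≠ 0) : ∃ (n : ℤ) (c : K), c ≠ 0 ∧ ∀ V : ValuationSubring (CurveField d),
      IsInfiniteRing V → HasLeading V (curveY d) 2 ε → HasLeading V f n c := by
  have poly : ∀ p : K[X], p ≠ 0 → ∃ (n : ℤ) (c : K), c ≠ 0 ∧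
      ∀ V : ValuationSubring (CurveField d), IsInfiniteRing V → HasLeading V (curveY d) 2 ε →
        HasLeading V (algebraMap K[X] (CurveField d) p) n c := fun p hp =>
    ⟨_, _, leadingCoeff_ne_zero.2 hp, fun V hV _ => HasLeading.polynomial hV _ p le_rfl⟩
  have main : ∀ p q : K[X], algebraMap K[X] (CurveField d) p
      + algebraMap K[X] (CurveField d) q * curveY d ≠ 0 → ∃ (n : ℤ) (c : K), c ≠ 0 ∧
      ∀ V : ValuationSubring (CurveField d), IsInfiniteRing V → HasLeading V (curveY d) 2 ε →
        HasLeading V (algebraMap K[X] (CurveField d) p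
          + algebraMap K[X] (CurveField d) q * curveY d) n c := by
    intro p q hpq
    by_cases hq : q = 0
    · subst hq
      rw [map_zero, zero_mul, add_zero] at hpq ⊢
      exact poly p (by rintro rfl; simp at hpq)
    obtain ⟨n, hqn, hpn, hn⟩ : ∃ n, q.natDegree ≤ n ∧ p.natDegree ≤ n + 2 ∧
        (p.coeff (n + 2) ≠ 0 ∨ q.coeff n ≠ 0) := by
      by_cases h : p.natDegree ≤ q.natDegree + 2
      · exact ⟨q.natDegree, le_rfl, h, Or.inr (leadingCoeff_ne_zero.2 hq)⟩
      · refine ⟨p.natDegree - 2, by omega, by omega, Or.inl ?_⟩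
        rw [show p.natDegree - 2 + 2 = p.natDegree by omega, coeff_natDegree,
          leadingCoeff_ne_zero]
        rintro rfl
        simp at h
    by_cases h0 : p.coeff (n + 2) + q.coeff n * ε = 0
    -- If the leading terms of p and qy cancel, those of p and -qy do not, as 2 ≠ 0. The leading
    -- term is then read off from p + qy = (p² - dq²)/(p - qy).
    · obtain ⟨m, c, hc, hm⟩ := poly _ (norm_ne_zero hpq)
      have h1 : p.coeff (n + 2) + (-q).coeff n * ε ≠ 0 := by
        intro h1
        rw [coeff_neg] at h1
        have hp0 : p.coeff (n + 2) = 0 := by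
          have : (2 : K) * p.coeff (n + 2) = 0 := by linear_combination h0 + h1
          exact (mul_eq_zero.1 this).resolve_left two_ne_zero
        have hε0 : ε ≠ 0 := by rintro rfl; simp at hε
        rw [hp0, zero_add] at h0
        exact hn.elim (fun h => h hp0) fun h => h ((mul_eq_zero.1 h0).resolve_right hε0)
      refine ⟨m + -(n + 2 : ℤ), _, mul_ne_zero hc (inv_ne_zero h1), fun V hV hY => ?_⟩
      have h := (hm V hV hY).mul hV ((HasLeading.add_mul_Y hV hY n hpn
        ((natDegree_neg q).le.trans hqn)).inv hV h1)
      have hne : algebraMap K[X] (CurveField d) p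
          - algebraMap K[X] (CurveField d) q * curveY d ≠ 0 := by
        have := (map_ne_zero_iff _ (algebraMap_curveField_injective (d := d))).2
          (norm_ne_zero hpq)
        rw [algebraMap_norm] at this
        exact right_ne_zero_of_mul this
      rwa [algebraMap_norm, map_neg, neg_mul, ← sub_eq_add_neg, mul_assoc, mul_inv_cancel₀ hne,
        mul_one] at h
    · exact ⟨_, _, h0, fun V hV hY => HasLeading.add_mul_Y hV hY n hpn hqn⟩
  obtain ⟨p, q, r, hr, h⟩ := exists_polynomial_add_mul f
  have hr' : algebraMap K[X] (CurveField d) r ≠ 0 :=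
    (map_ne_zero_iff _ algebraMap_curveField_injective).2 hr
  obtain ⟨n, c, hc, hn⟩ := main p q (by rw [← h]; exact mul_ne_zero hf hr')
  obtain ⟨m, e, he, hm⟩ := poly r hr
  refine ⟨n + -m, _, mul_ne_zero hc (inv_ne_zero he), fun V hV hY => ?_⟩
  have := (hn V hV hY).mul hV ((hm V hV hY).inv hV he)
  rwa [← h, mul_assoc, mul_inv_cancel₀ hr', mul_one] at this

/-- A valuation ring at infinity is determined by the leading coefficient of `y`. -/
lemma IsInfiniteRing.eq_of_hasLeading [NeZero (2 : K)] {ε : K} (hε : ε ^ 2 = 1)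
    {V W : ValuationSubring (CurveField d)} (hV : IsInfiniteRing V) (hW : IsInfiniteRing W)
    (hVY : HasLeading V (curveY d) 2 ε) (hWY : HasLeading W (curveY d) 2 ε) : V = W := by
  ext f
  by_cases hf : f = 0
  · simp [hf]
  · obtain ⟨n, c, hc, h⟩ := exists_hasLeading hε hf
    rw [(h V hV hVY).mem_iff hV hc, (h W hW hWY).mem_iff hW hc]

/-- The inverse of x is a uniformizer: a nonzero element of V with leading term c·xⁿ has n ≤ 0 and
is a unit times x⁻¹ to the power -n. -/
lemma IsInfiniteRing.isDiscreteValuationRing [NeZero (2 : K)] {ε : K} (hε : ε ^ 2 = 1)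
    (hV : IsInfiniteRing V) (hY : HasLeading V (curveY d) 2 ε) :
    IsDiscreteValuationRing V := by
  have hx : (curveX d)⁻¹ ∈ V := (V.mem_or_inv_mem _).resolve_left hV.x_not_mem
  have hlt : V.valuation (curveX d)⁻¹ < 1 := by
    rw [map_inv₀]; exact inv_lt_one_of_one_lt₀ hV.one_lt_valuation_X
  have key : ∀ {f : V}, f ≠ 0 → ∃ n : ℕ, Associated ((⟨_, hx⟩ : V) ^ n) f := by
    intro f hf
    have hf' : (f : CurveField d) ≠ 0 := by simpa using hf
    obtain ⟨n, c, hc, h⟩ := exists_hasLeading hε hf'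
    obtain ⟨k, hk⟩ := Int.eq_ofNat_of_zero_le
      (neg_nonneg.2 (((h V hV hY).mem_iff hV hc).1 f.2))
    obtain ⟨u, hu⟩ := (V.valuation_eq_iff f ((curveX d)⁻¹ ^ k)).1 (by
      rw [(h V hV hY).valuation_eq hV hc, map_pow, map_inv₀, inv_pow, ← zpow_natCast, ← zpow_neg,
        ← hk, neg_neg])
    exact ⟨k, u, Subtype.ext (by rw [← hu, mul_comm]; rfl)⟩
  refine IsDiscreteValuationRing.ofHasUnitMulPowIrreducibleFactorization
    ⟨⟨_, hx⟩, ⟨fun hu => hlt.ne ((V.valuation_eq_one_iff _).1 hu), fun a b hab => ?_⟩, key⟩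
  have hval : ∀ {i : ℕ} {e : V}, Associated ((⟨_, hx⟩ : V) ^ i) e →
      V.valuation e = V.valuation (curveX d)⁻¹ ^ i := by
    rintro i _ ⟨u, rfl⟩
    rw [← map_pow]
    exact (V.valuation_eq_iff _ _).2 ⟨u, mul_comm _ _⟩
  have hne : a * b ≠ 0 := by
    rw [← hab]
    exact fun h => inv_ne_zero curveX_ne_zero (congrArg Subtype.val h)
  obtain ⟨i, hi⟩ := key (left_ne_zero_of_mul hne)
  obtain ⟨j, hj⟩ := key (right_ne_zero_of_mul hne)
  have hij : V.valuation (curveX d)⁻¹ ^ 1 = V.valuation (curveX d)⁻¹ ^ (i + j) := by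
    rw [pow_one, pow_add, ← hval hi, ← hval hj, ← map_mul]
    exact congrArg (fun z : V => V.valuation (z : CurveField d)) hab
  have hpos : 0 < V.valuation (curveX d)⁻¹ :=
    zero_lt_iff.2 ((V.valuation.ne_zero_iff).2 (inv_ne_zero curveX_ne_zero))
  have := pow_right_injective₀ hpos hlt.ne hij
  rcases Nat.eq_zero_or_pos i with h0 | h0
  · rw [h0, pow_zero] at hi
    exact Or.inl (associated_one_iff_isUnit.1 hi.symm)
  · obtain rfl : j = 0 := by omega
    rw [pow_zero] at hj
    exact Or.inr (associated_one_iff_isUnit.1 hj.symm)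

/-- If `d` is a monic quartic then `y` is `x ^ 2` or `-x ^ 2` to first order at infinity. -/
lemma IsInfiniteRing.hasLeading_Y (hV : IsInfiniteRing V) (hd : d.Monic) (h4 : d.natDegree = 4) :
    HasLeading V (curveY d) 2 1 ∨ HasLeading V (curveY d) 2 (-1) := by
  have h := HasLeading.polynomial hV 4 d h4.le
  have h1 : d.coeff 4 = 1 := by rw [← h4]; exact hd
  rw [← curveY_sq, h1, HasLeading, map_one] at h
  -- Since y²/x⁴ ≡ 1, the product (y/x² - 1)(y/x² + 1) lies in the maximal ideal, hence one of its
  -- factors does.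
  have hfac : curveY d ^ 2 * curveX d ^ (-((4 : ℕ) : ℤ)) - 1
      = (curveY d * curveX d ^ (-2 : ℤ) - 1) * (curveY d * curveX d ^ (-2 : ℤ) + 1) := by
    have : curveX d ^ (-((4 : ℕ) : ℤ)) = curveX d ^ (-2 : ℤ) * curveX d ^ (-2 : ℤ) := by
      rw [← zpow_add₀ curveX_ne_zero]; norm_num
    rw [this]; ring
  rw [hfac, map_mul] at h
  unfold HasLeading
  rw [map_neg, map_one, sub_neg_eq_add]
  by_contra! hcon
  exact absurd h (not_lt.2 (hcon.2.trans (le_mul_of_one_le_left zero_le hcon.1)))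

lemma HasLeading.unique (hV : IsInfiniteRing V) {f : CurveField d} {n : ℤ} {c e : K}
    (h : HasLeading V f n c) (h' : HasLeading V f n e) : c = e := by
  have := V.valuation.map_sub_lt h' h
  rw [sub_sub_sub_cancel_left, ← map_sub] at this
  exact sub_eq_zero.1 (hV.eq_zero_of_valuation_lt this)

lemma mem_comap_conj {f : CurveField d} :
    f ∈ V.comap (curveConj d : CurveField d →+* CurveField d) ↔ curveConj d f ∈ V :=
  Iff.rfl

lemma IsInfiniteRing.comap (hV : IsInfiniteRing V) :
    IsInfiniteRing (V.comap (curveConj d : CurveField d →+* CurveField d)) where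
  const_mem c := by
    rw [mem_comap_conj, curveConj_const]; exact hV.const_mem c
  x_not_mem := by
    rw [mem_comap_conj, curveConj_X]; exact hV.x_not_mem

/-- Phrasing strict inequality as membership lets it pass to `V.comap`, whose value group is a
different type. -/
lemma valuation_lt_one_iff_inv_notMem {f : CurveField d} (hf : f ≠ 0) :
    V.valuation f < 1 ↔ f⁻¹ ∉ V := by
  rw [← V.valuation_le_one_iff, map_inv₀, inv_le_one₀
    (zero_lt_iff.2 ((V.valuation.ne_zero_iff).2 hf)), not_le]

lemma valuation_comap_lt_one_iff {f : CurveField d} :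
    (V.comap (curveConj d : CurveField d →+* CurveField d)).valuation f < 1
      ↔ V.valuation (curveConj d f) < 1 := by
  by_cases hf : f = 0
  · simp [hf]
  · rw [valuation_lt_one_iff_inv_notMem hf,
      valuation_lt_one_iff_inv_notMem ((map_ne_zero (curveConj d)).2 hf), mem_comap_conj, map_inv₀]

lemma HasLeading.comap {f : CurveField d} {n : ℤ} {c : K} (h : HasLeading V (curveConj d f) n c) :
    HasLeading (V.comap (curveConj d : CurveField d →+* CurveField d)) f n c := by
  rw [HasLeading, valuation_comap_lt_one_iff]
  simpa [HasLeading] using h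

lemma HasLeading.neg {f : CurveField d} {n : ℤ} {c : K} (h : HasLeading V f n c) :
    HasLeading V (-f) n (-c) := by
  rw [HasLeading, map_neg, show -f * curveX d ^ (-n) - -algebraMap K (CurveField d) c
    = -(f * curveX d ^ (-n) - algebraMap K (CurveField d) c) by ring, Valuation.map_neg]
  exact h

-- As x is transcendental over K, it lies outside the integral closure of K, and some valuation ring
-- above that closure avoids it.
variable (d) in
lemma exists_isInfiniteRing : ∃ V : ValuationSubring (CurveField d), IsInfiniteRing V := by
  have hx : curveX d ∉ (integralClosure K (CurveField d)).toSubring := by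
    intro h
    have h' : IsIntegral K (curveX d) := h
    rw [← algebraMap_X_curveField] at h'
    have := (isIntegral_algHom_iff (IsScalarTower.toAlgHom K K[X] (CurveField d))
      algebraMap_curveField_injective).1 h'
    exact transcendental_X K this.isAlgebraic
  have : IsIntegrallyClosedIn (integralClosure K (CurveField d)).toSubring (CurveField d) :=
    inferInstanceAs (IsIntegrallyClosedIn (integralClosure K (CurveField d)) (CurveField d))
  obtain ⟨V, hle, hV⟩ := Subring.exists_le_valuationSubring_of_isIntegrallyClosedIn hx
  exact ⟨V, fun c => hle (Subalgebra.algebraMap_mem _ c), hV⟩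

/-- Both signs of the leading coefficient of `y` occur. -/
lemma exists_isInfiniteRing_hasLeading (hd : d.Monic) (h4 : d.natDegree = 4) {ε : K}
    (hε : ε = 1 ∨ ε = -1) : ∃ V : ValuationSubring (CurveField d), IsInfiniteRing V ∧
      HasLeading V (curveY d) 2 ε := by
  obtain ⟨V, hV⟩ := exists_isInfiniteRing d
  have flip : ∀ {η : K}, HasLeading V (curveY d) 2 η →
      HasLeading (V.comap (curveConj d : CurveField d →+* CurveField d)) (curveY d) 2 (-η) :=
    fun h => HasLeading.comap (by rw [curveConj_Y]; exact h.neg)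
  rcases hε with rfl | rfl <;> rcases hV.hasLeading_Y hd h4 with h | h
  · exact ⟨V, hV, h⟩
  · exact ⟨_, hV.comap, by simpa using flip h⟩
  · exact ⟨_, hV.comap, flip h⟩
  · exact ⟨V, hV, h⟩

end Leading

/-! ### Places at infinity and the ring of functions regular at finite places. -/

section Places

namespace Place

variable {K F : Type*} [Field K] [Field F] [Algebra K F] (P : Place K F)

lemma valuation_le_one_iff (f : F) :
    (IsDiscreteValuationRing.maximalIdeal P.ring).valuation F f ≤ 1 ↔ f ∈ P.ring := by
  constructor
  · intro h
    obtain ⟨a, rfl⟩ := IsDiscreteValuationRing.exists_lift_of_le_one h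
    exact a.2
  · intro h
    exact IsDedekindDomain.HeightOneSpectrum.valuation_le_one _ (⟨f, h⟩ : P.ring)

lemma ord_nonneg_iff {f : F} (hf : f ≠ 0) : 0 ≤ P.ord f ↔ f ∈ P.ring := by
  have h0 : (IsDiscreteValuationRing.maximalIdeal P.ring).valuation F f ≠ 0 :=
    (Valuation.ne_zero_iff _).2 hf
  rw [← P.valuation_le_one_iff, ord, Left.nonneg_neg_iff, ← WithZero.log_one,
    WithZero.log_le_log h0 one_ne_zero]

lemma ord_eq_zero_iff {f : F} (hf : f ≠ 0) : P.ord f = 0 ↔ f ∈ P.ring ∧ f⁻¹ ∈ P.ring := by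
  rw [← P.ord_nonneg_iff hf, ← P.ord_nonneg_iff (inv_ne_zero hf), ord_inv]
  omega

lemma exists_ord_eq_one : ∃ f : F, f ≠ 0 ∧ P.ord f = 1 := by
  obtain ⟨f, hf⟩ := (IsDiscreteValuationRing.maximalIdeal P.ring).valuation_exists_uniformizer F
  refine ⟨f, ?_, by simp [ord, hf]⟩
  rintro rfl
  rw [map_zero] at hf
  exact WithZero.exp_ne_zero hf.symm

lemma ord_zpow (f : F) (n : ℤ) : P.ord (f ^ n) = n * P.ord f := by
  rw [ord, ord, map_zpow₀, WithZero.log_zpow]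
  simp

lemma ext_ring {P Q : Place K F} (h : P.ring = Q.ring) : P = Q := by
  cases P; cases Q; congr

end Place

variable {K : Type*} [Field K] {d : K[X]} [Fact (Irreducible (curvePolynomial d))]

lemma Place.isInfinite_iff (P : Place K (CurveField d)) :
    P.IsInfinite ↔ IsInfiniteRing P.ring :=
  ⟨fun h => ⟨P.algebraMap_mem, h⟩, fun h => h.x_not_mem⟩

/-- The order at infinity of a function with a given leading term. -/
lemma Place.ord_eq_neg [NeZero (2 : K)] (P : Place K (CurveField d)) (hP : IsInfiniteRing P.ring)
    {ε : K} (hε : ε ^ 2 = 1) (hY : HasLeading P.ring (curveY d) 2 ε) {f : CurveField d} {n : ℤ}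
    {c : K} (hc : c ≠ 0) (h : HasLeading P.ring f n c) : P.ord f = -n := by
  have key : ∀ {f : CurveField d} {n : ℤ} {c : K}, c ≠ 0 → f ≠ 0 → HasLeading P.ring f n c →
      P.ord f = n * P.ord (curveX d) := by
    intro f n c hc hf h
    have hx : curveX d ^ (-n) ≠ 0 := zpow_ne_zero _ curveX_ne_zero
    have h1 := h.valuation_mul_eq hP hc
    have h0 : P.ord (f * curveX d ^ (-n)) = 0 := by
      rw [P.ord_eq_zero_iff (mul_ne_zero hf hx), ← P.ring.valuation_le_one_iff,
        ← P.ring.valuation_le_one_iff, map_inv₀, h1]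
      simp
    rw [P.ord_mul hf hx, P.ord_zpow] at h0
    linarith
  have hf : f ≠ 0 := by
    rintro rfl
    have := h.valuation_mul_eq hP hc
    simp at this
  -- All orders are multiples of ord x. A function of order 1 forces ord x = ±1, and the pole of x
  -- settles the sign.
  obtain ⟨u, hu, hu1⟩ := P.exists_ord_eq_one
  obtain ⟨m, e, he, hm⟩ := exists_hasLeading hε hu
  have hx1 := key he hu (hm _ hP hY)
  have hx : P.ord (curveX d) < 0 := by
    rw [← not_le, P.ord_nonneg_iff curveX_ne_zero]
    exact hP.x_not_mem
  have : P.ord (curveX d) = -1 := by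
    rcases Int.eq_one_or_neg_one_of_mul_eq_one' (hx1.symm.trans hu1) with h | h <;> omega
  rw [key hc hf h, this]; ring

/-- Places at infinity have degree one. -/
lemma Place.degree_eq_one [NeZero (2 : K)] (P : Place K (CurveField d))
    (hP : IsInfiniteRing P.ring) {ε : K} (hε : ε ^ 2 = 1)
    (hY : HasLeading P.ring (curveY d) 2 ε) : P.degree = 1 := by
  unfold Place.degree
  rw [finrank_eq_one_iff_of_nonzero' (1 : IsLocalRing.ResidueField P.ring) one_ne_zero]
  intro w
  obtain ⟨f, rfl⟩ := IsLocalRing.residue_surjective w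
  suffices h : ∃ c : K, P.ring.valuation (f - algebraMap K (CurveField d) c) < 1 by
    obtain ⟨c, hc⟩ := h
    refine ⟨c, ?_⟩
    have hmem : f - algebraMap K P.ring c ∈ IsLocalRing.maximalIdeal P.ring :=
      (P.ring.valuation_lt_one_iff _).2 hc
    rw [← IsLocalRing.residue_eq_zero_iff, map_sub, sub_eq_zero] at hmem
    rw [hmem, Algebra.smul_def, mul_one]
    rfl
  by_cases hf : (f : CurveField d) = 0
  · exact ⟨0, by simp [hf]⟩
  obtain ⟨n, c, hc, h⟩ := exists_hasLeading hε hf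
  have h := h _ hP hY
  rcases ((h.mem_iff hP hc).1 f.2).lt_or_eq with hn | rfl
  · refine ⟨0, ?_⟩
    rw [map_zero, sub_zero, h.valuation_eq hP hc]
    exact zpow_lt_one_of_neg₀ hP.one_lt_valuation_X hn
  · exact ⟨c, by simpa [HasLeading] using h⟩

/-- The two places at infinity. -/
lemma exists_infinite_places [NeZero (2 : K)] (hd : d.Monic) (h4 : d.natDegree = 4) :
    ∃ P Q : Place K (CurveField d), P ≠ Q ∧
      (∀ R : Place K (CurveField d), R.IsInfinite ↔ R = P ∨ R = Q) ∧
      IsInfiniteRing P.ring ∧ IsInfiniteRing Q.ring ∧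
      HasLeading P.ring (curveY d) 2 1 ∧ HasLeading Q.ring (curveY d) 2 (-1) := by
  obtain ⟨V, hV, hVY⟩ := exists_isInfiniteRing_hasLeading hd h4 (ε := 1) (Or.inl rfl)
  obtain ⟨W, hW, hWY⟩ := exists_isInfiniteRing_hasLeading hd h4 (ε := -1) (Or.inr rfl)
  refine ⟨⟨V, hV.const_mem, hV.isDiscreteValuationRing (one_pow 2) hVY⟩,
    ⟨W, hW.const_mem, hW.isDiscreteValuationRing (by norm_num) hWY⟩, ?_, fun R => ⟨?_, ?_⟩,
    hV, hW, hVY, hWY⟩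
  · intro h
    obtain rfl : V = W := congrArg Place.ring h
    have h2 : (2 : K) = 0 := by linear_combination hVY.unique hV hWY
    exact two_ne_zero h2
  · intro hR
    have hR := R.isInfinite_iff.1 hR
    rcases hR.hasLeading_Y hd h4 with h | h
    · exact Or.inl (Place.ext_ring (hR.eq_of_hasLeading (one_pow 2) hV h hVY))
    · exact Or.inr (Place.ext_ring (hR.eq_of_hasLeading (by norm_num) hW h hWY))
  · rintro (rfl | rfl)
    exacts [hV.x_not_mem, hW.x_not_mem]

/-! ### Functions without zeros or poles at finite places -/

lemma finiteDimensional_curveField : FiniteDimensional (RatFunc K) (CurveField d) :=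
  (AdjoinRoot.powerBasis (Fact.out : Irreducible (curvePolynomial d)).ne_zero).finite

/-- The integral closure of K[x] is Dedekind, so integrality can be tested at its primes, each of
which gives a finite place. -/
lemma isIntegral_of_mem_finite_places [CharZero K] {f : CurveField d}
    (h : ∀ P : Place K (CurveField d), ¬ P.IsInfinite → f ∈ P.ring) : IsIntegral K[X] f := by
  have := finiteDimensional_curveField (d := d)
  have : IsDedekindDomain (integralClosure K[X] (CurveField d)) :=
    integralClosure.isDedekindDomain K[X] (RatFunc K) (CurveField d)
  have : IsFractionRing (integralClosure K[X] (CurveField d)) (CurveField d) :=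
    integralClosure.isFractionRing_of_finite_extension (RatFunc K) (CurveField d)
  suffices hf : f ∈ (algebraMap (integralClosure K[X] (CurveField d)) (CurveField d)).range by
    obtain ⟨g, rfl⟩ := hf
    exact g.2
  apply IsDedekindDomain.HeightOneSpectrum.mem_integers_of_valuation_le_one
  intro v
  have hB : ∀ g : integralClosure K[X] (CurveField d),
      (g : CurveField d) ∈ v.valuationSubringAtPrime (CurveField d) := fun g =>
    (algebraMap _ (v.valuationSubringAtPrime (CurveField d)) g).2
  have hp : ∀ p : K[X], algebraMap K[X] (CurveField d) p
      ∈ v.valuationSubringAtPrime (CurveField d) := fun p => hB (algebraMap _ _ p)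
  let P : Place K (CurveField d) :=
    { ring := v.valuationSubringAtPrime (CurveField d)
      algebraMap_mem := fun c => by rw [← algebraMap_C_curveField]; exact hp _
      isDVR := IsLocalization.AtPrime.isDiscreteValuationRing_of_dedekind_domain _ v.ne_bot _ }
  have hP : ¬ P.IsInfinite := fun hP => hP (by
    have := hp X
    rwa [algebraMap_X_curveField] at this)
  exact v.valuationSubringAtPrime_le_valuation (h P hP)

/-- A rational function whose square becomes polynomial after multiplication by a squarefree
polynomial is a polynomial. -/
lemma exists_algebraMap_eq_of_sq_mul {K : Type*} [Field K] {d s : K[X]} (hsq : Squarefree d)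
    {β : RatFunc K} (h : β ^ 2 * algebraMap K[X] (RatFunc K) d = algebraMap K[X] (RatFunc K) s) :
    ∃ q : K[X], algebraMap K[X] (RatFunc K) q = β := by
  have ht : algebraMap K[X] (RatFunc K) β.denom ≠ 0 :=
    RatFunc.algebraMap_ne_zero β.denom_ne_zero
  have hβ : β * algebraMap K[X] (RatFunc K) β.denom = algebraMap K[X] (RatFunc K) β.num := by
    conv_lhs => enter [1]; rw [← β.num_div_denom]
    exact div_mul_cancel₀ _ ht
  have hpoly : β.num ^ 2 * d = s * β.denom ^ 2 := by
    apply IsFractionRing.injective K[X] (RatFunc K)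
    rw [map_mul, map_mul, map_pow, map_pow, ← hβ, ← h]
    ring
  have hdvd : β.denom ^ 2 ∣ d :=
    (β.isCoprime_num_denom.symm.pow (m := 2) (n := 2)).dvd_of_dvd_mul_left
      (hpoly ▸ dvd_mul_left _ _)
  obtain ⟨u, hu⟩ := (hsq _ (by rwa [← sq])).exists_right_inv
  refine ⟨β.num * u, ?_⟩
  rw [map_mul, ← hβ, mul_assoc, ← map_mul, hu, map_one, mul_one]

/-- If `d` is squarefree, the functions integral over `K[x]` are `K[x] + K[x] y`. -/
lemma exists_polynomial_of_isIntegral [NeZero (2 : K)] (hsq : Squarefree d) {f : CurveField d}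
    (hf : IsIntegral K[X] f) : ∃ p q : K[X], f = algebraMap K[X] (CurveField d) p
      + algebraMap K[X] (CurveField d) q * curveY d := by
  have descend : ∀ {α : RatFunc K}, IsIntegral K[X] (algebraMap (RatFunc K) (CurveField d) α) →
      ∃ p : K[X], algebraMap K[X] (RatFunc K) p = α := fun h =>
    IsIntegrallyClosed.isIntegral_iff.1
      ((isIntegral_algHom_iff (IsScalarTower.toAlgHom K[X] (RatFunc K) (CurveField d))
        (algebraMap (RatFunc K) (CurveField d)).injective).1 h)
  obtain ⟨α, β, rfl⟩ := exists_ratFunc_add_mul f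
  -- Half the sum and half the difference of f and its conjugate are α and βy, so both are integral,
  -- and (βy)² = β²d is a polynomial.
  have hconj := hf.map ((curveConj d).restrictScalars K[X])
  have h2 : IsIntegral K[X] (algebraMap K[X] (CurveField d) (C 2⁻¹)) := isIntegral_algebraMap
  have hhalf : algebraMap K[X] (CurveField d) (C 2⁻¹) * 2 = 1 := by
    have : (C (2 : K)⁻¹ : K[X]) * 2 = 1 := by
      rw [← C_ofNat, ← C_mul, inv_mul_cancel₀ two_ne_zero, C_1]
    rw [← map_ofNat (algebraMap K[X] (CurveField d)) 2, ← map_mul, this, map_one]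
  simp only [AlgHom.coe_restrictScalars', map_add, map_mul, AlgHom.commutes, curveConj_Y] at hconj
  have hα : IsIntegral K[X] (algebraMap (RatFunc K) (CurveField d) α) := by
    have h := h2.mul (hf.add hconj)
    rwa [show algebraMap K[X] (CurveField d) (C 2⁻¹)
        * (algebraMap (RatFunc K) (CurveField d) α
          + algebraMap (RatFunc K) (CurveField d) β * curveY d
          + (algebraMap (RatFunc K) (CurveField d) α
            + algebraMap (RatFunc K) (CurveField d) β * -curveY d))
        = algebraMap (RatFunc K) (CurveField d) α by
      linear_combination algebraMap (RatFunc K) (CurveField d) α * hhalf] at h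
  obtain ⟨p, hp⟩ := descend hα
  have hβ : IsIntegral K[X] (algebraMap (RatFunc K) (CurveField d) β * curveY d) := by
    have h := h2.mul (hf.sub hconj)
    rwa [show algebraMap K[X] (CurveField d) (C 2⁻¹)
        * (algebraMap (RatFunc K) (CurveField d) α
          + algebraMap (RatFunc K) (CurveField d) β * curveY d
          - (algebraMap (RatFunc K) (CurveField d) α
            + algebraMap (RatFunc K) (CurveField d) β * -curveY d))
        = algebraMap (RatFunc K) (CurveField d) β * curveY d by
      linear_combination algebraMap (RatFunc K) (CurveField d) β * curveY d * hhalf] at h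
  obtain ⟨s, hs⟩ := descend (α := β ^ 2 * algebraMap K[X] (RatFunc K) d) (by
    rw [map_mul, map_pow, ← IsScalarTower.algebraMap_apply, ← curveY_sq, ← mul_pow]
    exact hβ.pow 2)
  obtain ⟨q, hq⟩ := exists_algebraMap_eq_of_sq_mul hsq hs.symm
  refine ⟨p, q, ?_⟩
  rw [IsScalarTower.algebraMap_apply K[X] (RatFunc K) (CurveField d),
    IsScalarTower.algebraMap_apply K[X] (RatFunc K) (CurveField d), hp, hq]

/-- Both f and its inverse are integral, so the norm of f is a unit of K[x], that is, a nonzero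
constant. -/
lemma exists_unit_of_ord_eq_zero [CharZero K] (hsq : Squarefree d) {f : CurveField d}
    (hf0 : f ≠ 0) (h : ∀ P : Place K (CurveField d), ¬ P.IsInfinite → P.ord f = 0) :
    ∃ (p q : K[X]) (c : K), c ≠ 0 ∧ p ^ 2 - d * q ^ 2 = C c ∧
      f = algebraMap K[X] (CurveField d) p + algebraMap K[X] (CurveField d) q * curveY d := by
  have hf : IsIntegral K[X] f :=
    isIntegral_of_mem_finite_places fun P hP => ((P.ord_eq_zero_iff hf0).1 (h P hP)).1
  have hfi : IsIntegral K[X] f⁻¹ :=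
    isIntegral_of_mem_finite_places fun P hP => ((P.ord_eq_zero_iff hf0).1 (h P hP)).2
  obtain ⟨p, q, rfl⟩ := exists_polynomial_of_isIntegral hsq hf
  obtain ⟨r, s, hrs⟩ := exists_polynomial_of_isIntegral hsq hfi
  have hconj := congrArg (curveConj d) hrs
  simp only [map_inv₀, map_add, map_mul, curveConj_algebraMap, curveConj_Y, mul_neg,
    ← sub_eq_add_neg] at hconj
  have hunit : IsUnit (p ^ 2 - d * q ^ 2) := by
    refine IsUnit.of_mul_eq_one (r ^ 2 - d * s ^ 2) ?_
    apply algebraMap_curveField_injective (d := d)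
    rw [map_mul, map_one, algebraMap_norm, algebraMap_norm, ← hrs, ← hconj, ← mul_inv,
      ← algebraMap_norm]
    exact mul_inv_cancel₀ ((map_ne_zero_iff _ algebraMap_curveField_injective).2
      (norm_ne_zero hf0))
  obtain ⟨c, hc, hcn⟩ := isUnit_iff.1 hunit
  exact ⟨p, q, c, hc.ne_zero, hcn.symm, rfl⟩

end Places

/-! ### From units to the order of ∞₊ - ∞₋. -/

section Order

variable {K : Type*} [Field K] {d : K[X]}

section FinitePlaces

variable [Fact (Irreducible (curvePolynomial d))] {R : Place K (CurveField d)}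

lemma Place.polynomial_mem (hR : ¬ R.IsInfinite) (p : K[X]) :
    algebraMap K[X] (CurveField d) p ∈ R.ring := by
  have hx : algebraMap K[X] (CurveField d) X ∈ R.ring := by
    rw [algebraMap_X_curveField]; exact not_not.1 hR
  have hc : ∀ c : K, algebraMap K[X] (CurveField d) (C c) ∈ R.ring := fun c => by
    rw [algebraMap_C_curveField]; exact R.algebraMap_mem c
  induction p using Polynomial.induction_on with
  | C c => exact hc c
  | add p q hp hq => rw [map_add]; exact R.ring.add_mem _ _ hp hq
  | monomial n c _ => rw [map_mul, map_pow]; exact R.ring.mul_mem _ _ (hc c) (pow_mem hx _)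

/-- If instead 1/y is regular, then y = d·(1/y) is regular as well. -/
lemma Place.curveY_mem (hR : ¬ R.IsInfinite) : curveY d ∈ R.ring := by
  rcases R.ring.mem_or_inv_mem (curveY d) with h | h
  · exact h
  · have h2 := R.ring.mul_mem _ _ (R.polynomial_mem hR d) h
    rwa [← curveY_sq, sq, mul_assoc, mul_inv_cancel₀ curveY_ne_zero, mul_one] at h2

lemma Place.ord_eq_zero_of_norm (hR : ¬ R.IsInfinite) {p q : K[X]} {c : K} (hc : c ≠ 0)
    (h : p ^ 2 - d * q ^ 2 = C c) : R.ord (algebraMap K[X] (CurveField d) p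
      + algebraMap K[X] (CurveField d) q * curveY d) = 0 := by
  have hN := algebraMap_norm (d := d) p q
  have hc0 : algebraMap K (CurveField d) c ≠ 0 := by simpa using hc
  rw [h, algebraMap_C_curveField] at hN
  have hf : algebraMap K[X] (CurveField d) p + algebraMap K[X] (CurveField d) q * curveY d ≠ 0 := by
    intro h0
    rw [h0, zero_mul] at hN
    exact hc0 hN
  have hy := R.ring.mul_mem _ _ (R.polynomial_mem hR q) (R.curveY_mem hR)
  refine (R.ord_eq_zero_iff hf).2 ⟨R.ring.add_mem _ _ (R.polynomial_mem hR p) hy, ?_⟩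
  have hinv : (algebraMap K[X] (CurveField d) p
      + algebraMap K[X] (CurveField d) q * curveY d)⁻¹
      = algebraMap K (CurveField d) c⁻¹ * (algebraMap K[X] (CurveField d) p
        - algebraMap K[X] (CurveField d) q * curveY d) := by
    symm
    apply eq_inv_of_mul_eq_one_left
    rw [mul_assoc, mul_comm (_ - _), ← hN, map_inv₀, inv_mul_cancel₀ hc0]
  rw [hinv]
  exact R.ring.mul_mem _ _ (R.algebraMap_mem _) (sub_mem (R.polynomial_mem hR p) hy)

end FinitePlaces

/-- The divisor `k (P - Q)` is principal exactly when `d` has a unit of degree `k`. -/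
lemma nsmul_mem_principalDivisors_iff [Fact (Irreducible (curvePolynomial d))] [CharZero K]
    (hsq : Squarefree d) (hd : d.Monic) (h4 : d.natDegree = 4) {P Q : Place K (CurveField d)}
    (hPQ : P ≠ Q) (hinf : ∀ R : Place K (CurveField d), R.IsInfinite ↔ R = P ∨ R = Q)
    (hP : IsInfiniteRing P.ring) (hQ : IsInfiniteRing Q.ring)
    (hPY : HasLeading P.ring (curveY d) 2 1) (hQY : HasLeading Q.ring (curveY d) 2 (-1))
    {k : ℕ} (hk : 0 < k) :
    k • (Finsupp.single P 1 - Finsupp.single Q 1) ∈ principalDivisors K (CurveField d)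
      ↔ HasPellUnit d k := by
  have hDP : (k • (Finsupp.single P 1 - Finsupp.single Q 1) : PlaceDivisor K (CurveField d)) P
      = k := by
    simp [hPQ.symm]
  have hDQ : (k • (Finsupp.single P 1 - Finsupp.single Q 1) : PlaceDivisor K (CurveField d)) Q
      = -k := by
    simp [hPQ]
  have hDR : ∀ R : Place K (CurveField d), ¬ R.IsInfinite →
      (k • (Finsupp.single P 1 - Finsupp.single Q 1) : PlaceDivisor K (CurveField d)) R = 0 := by
    intro R hR
    rw [hinf, not_or] at hR
    simp [Ne.symm hR.1, Ne.symm hR.2]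
  have hordP : ∀ {p q : K[X]}, q.natDegree + 2 = p.natDegree →
      p.leadingCoeff + q.leadingCoeff ≠ 0 → P.ord (algebraMap K[X] (CurveField d) p
        + algebraMap K[X] (CurveField d) q * curveY d) = -p.natDegree := by
    intro p q hdeg hl
    have h := HasLeading.add_mul_Y hP hPY q.natDegree hdeg.ge le_rfl
    rw [hdeg, mul_one] at h
    rw [P.ord_eq_neg hP (one_pow 2) hPY hl h, ← hdeg]
    push_cast; rfl
  have hordQ : ∀ {p q : K[X]}, q.natDegree + 2 = p.natDegree →
      p.leadingCoeff - q.leadingCoeff ≠ 0 → Q.ord (algebraMap K[X] (CurveField d) p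
        + algebraMap K[X] (CurveField d) q * curveY d) = -p.natDegree := by
    intro p q hdeg hl
    have h := HasLeading.add_mul_Y hQ hQY q.natDegree hdeg.ge le_rfl
    rw [hdeg, mul_neg_one, ← sub_eq_add_neg] at h
    rw [Q.ord_eq_neg hQ (by norm_num) hQY hl h, ← hdeg]
    push_cast; rfl
  constructor
  · rintro ⟨f, hf, hD⟩
    obtain ⟨p, q, c, hc, hN, rfl⟩ := exists_unit_of_ord_eq_zero hsq hf fun R hR => by
      rw [← hD, hDR R hR]
    have hfP := (hD P).symm.trans hDP
    have hfQ := (hD Q).symm.trans hDQ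
    have hq : q ≠ 0 := by
      rintro rfl
      have hp : p ≠ 0 := by rintro rfl; simp at hf
      have hp0 : p.natDegree = 0 := by
        have := congrArg natDegree hN
        rw [zero_pow two_ne_zero, mul_zero, sub_zero, natDegree_pow, natDegree_C] at this
        omega
      rw [map_zero, zero_mul, add_zero, P.ord_eq_neg hP (one_pow 2) hPY
        (leadingCoeff_ne_zero.2 hp) (HasLeading.polynomial hP _ p le_rfl), hp0] at hfP
      simp at hfP
      omega
    obtain ⟨hdeg, hl⟩ := natDegree_and_leadingCoeff_of_norm hd h4 hq
      ((natDegree_C _).le.trans zero_le_one) hN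
    have hql : q.leadingCoeff ≠ 0 := leadingCoeff_ne_zero.2 hq
    refine ⟨p, q, c, hc, hq, ?_, hN⟩
    -- Equal leading coefficients would give a pole at P, where the order is k > 0. So they are
    -- opposite, and the pole at Q gives deg p = k.
    rcases sq_eq_sq_iff_eq_or_eq_neg.1 hl with h | h
    · have := (hordP hdeg.symm (by rw [h, ← two_mul]; exact mul_ne_zero two_ne_zero hql))
      omega
    · have := (hordQ hdeg.symm (by
        rw [h, ← neg_add', ← two_mul]; exact neg_ne_zero.2 (mul_ne_zero two_ne_zero hql)))
      omega
  · intro hu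
    obtain ⟨p, q, c, hc, hq, hqk, hpk, hl, hN⟩ := hu.exists_leadingCoeff_eq hd h4
    have hql : q.leadingCoeff ≠ 0 := leadingCoeff_ne_zero.2 hq
    have hc0 : algebraMap K (CurveField d) c ≠ 0 := by simpa using hc
    -- The function wanted is p - qy. Its leading terms add up at Q, giving a pole of order k. They
    -- cancel at P, where the order follows from (p - qy)(p + qy) = c.
    have hNneg : p ^ 2 - d * (-q) ^ 2 = C c := by rw [neg_sq, hN]
    have hmul := algebraMap_norm (d := d) p (-q)
    rw [hNneg, algebraMap_C_curveField, map_neg, neg_mul, sub_neg_eq_add, ← neg_mul,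
      ← map_neg] at hmul
    have hf : algebraMap K[X] (CurveField d) p
        + algebraMap K[X] (CurveField d) (-q) * curveY d ≠ 0 := by
      intro h0; rw [h0, zero_mul] at hmul; exact hc0 hmul
    have hg : algebraMap K[X] (CurveField d) p
        + algebraMap K[X] (CurveField d) q * curveY d ≠ 0 := by
      intro h0; rw [h0, mul_zero] at hmul; exact hc0 hmul
    refine ⟨_, hf, fun R => ?_⟩
    by_cases hR : R.IsInfinite
    · rcases (hinf R).1 hR with rfl | rfl
      · have h1 := congrArg R.ord hmul
        rw [R.ord_mul hf hg, hordP (p := p) (q := q) (by omega) (by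
          rw [hl, ← two_mul]; exact mul_ne_zero two_ne_zero hql), hpk,
          R.ord_eq_neg hP (one_pow 2) hPY hc (HasLeading.const c)] at h1
        rw [hDP]
        omega
      · rw [hDQ, hordQ (by rw [natDegree_neg]; omega) (by
          rw [leadingCoeff_neg, hl, sub_neg_eq_add, ← two_mul]
          exact mul_ne_zero two_ne_zero hql), hpk]
    · rw [hDR R hR, R.ord_eq_zero_of_norm hR hc hNneg]

/-- The order of `∞₊ - ∞₋` is the smallest degree of a unit. -/
theorem inftyDifferenceHasOrder_of_hasPellUnit [Fact (Irreducible (curvePolynomial d))]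
    [CharZero K] (hsq : Squarefree d) (hd : d.Monic) (h4 : d.natDegree = 4) {m : ℕ}
    (hm : HasPellUnit d m) (hmin : ∀ ℓ : ℕ, ℓ.Prime → ℓ ∣ m → ¬ HasPellUnit d (m / ℓ)) :
    InftyDifferenceHasOrder d m := by
  have hm0 : 0 < m := by have := two_le_of_hasPellUnit hd h4 hm; omega
  obtain ⟨P, Q, hPQ, hinf, hP, hQ, hPY, hQY⟩ := exists_infinite_places hd h4
  have hdeg : Finsupp.single P 1 - Finsupp.single Q 1 ∈ divisorZero K (CurveField d) := by
    rw [divisorZero, AddMonoidHom.mem_ker, map_sub]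
    simp [divisorDegree, P.degree_eq_one hP (one_pow 2) hPY,
      Q.degree_eq_one hQ (by norm_num) hQY]
  have key : ∀ {k : ℕ}, 0 < k → (k • (QuotientAddGroup.mk ⟨_, hdeg⟩ : PicZero K (CurveField d)) = 0
      ↔ HasPellUnit d k) := by
    intro k hk
    rw [← nsmul_mem_principalDivisors_iff hsq hd h4 hPQ hinf hP hQ hPY hQY hk,
      ← QuotientAddGroup.mk_nsmul, QuotientAddGroup.eq_zero_iff, AddSubgroup.mem_addSubgroupOf]
    rfl
  refine ⟨P, Q, hPQ, hinf, hdeg, hm0, addOrderOf_eq_of_nsmul_and_div_prime_nsmul hm0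
    ((key hm0).2 hm) fun ℓ hℓ hdvd h => hmin ℓ hℓ hdvd ((key ?_).1 h)⟩
  exact Nat.div_pos (Nat.le_of_dvd hm0 hdvd) hℓ.pos

lemma isPellian_of_hasPellUnit [NeZero (2 : K)] (hsq : Squarefree d) (hd : d.Monic)
    (h4 : d.natDegree = 4) {m : ℕ} (h : HasPellUnit d m) : IsPellian d := by
  refine ⟨?_, ?_⟩
  · rintro ⟨r, hr⟩
    have hu := hsq r (dvd_of_eq hr.symm)
    have := natDegree_eq_zero_of_isUnit (hr ▸ hu.mul hu)
    omega
  · obtain ⟨p, q, c, hc, hq, -, hN⟩ := h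
    have hp : p ≠ 0 := by
      rintro rfl
      have := (natDegree_and_leadingCoeff_of_norm hd h4 hq
        ((natDegree_C _).le.trans zero_le_one) hN).1
      rw [natDegree_zero] at this
      omega
    -- This is (p + q√d)²/c, whose norm is c²/c² = 1.
    refine ⟨C c⁻¹ * (p ^ 2 + d * q ^ 2), C c⁻¹ * (C 2 * (p * q)),
      mul_ne_zero (C_ne_zero.2 (inv_ne_zero hc))
        (mul_ne_zero (C_ne_zero.2 two_ne_zero) (mul_ne_zero hp hq)), ?_⟩
    have hcc : (C c⁻¹ * C c : K[X]) = 1 := by rw [← C_mul, inv_mul_cancel₀ hc, C_1]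
    calc _ = (C c⁻¹ * (p ^ 2 - d * q ^ 2)) ^ 2 := by rw [C_ofNat]; ring
      _ = 1 := by rw [hN, hcc, one_pow]

end Order

end

theorem theorem4p2 (m : ℕ) (r₂ r₁ r₀ : ℚ) [Fact (Squarefree (depressedQuartic r₂ r₁ r₀))]
    (hr : ∃ a b : ℚ, CoefficientTable m a b r₂ r₁ r₀) :
    IsPellian (depressedQuartic r₂ r₁ r₀) ∧
      InftyDifferenceHasOrder (depressedQuartic r₂ r₁ r₀) m := by
  obtain ⟨a, b, hab⟩ := hr
  have hsq : Squarefree (depressedQuartic r₂ r₁ r₀) := Fact.out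
  obtain ⟨hm, hmin⟩ := isPellOrder_of_coefficientTable hab hsq
  have hd := depressedQuartic_monic r₂ r₁ r₀
  have h4 := natDegree_depressedQuartic r₂ r₁ r₀
  exact ⟨isPellian_of_hasPellUnit hsq hd h4 hm,
    inftyDifferenceHasOrder_of_hasPellUnit hsq hd h4 hm hmin⟩
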